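/- Let $M$ be a complex manifold of dimension $n$ with a (smooth) Hermitian metric $\omega$, and write $\langle X,Y\rangle_\omega$, $|X|_\omega^2=\omega(X,\bar X)$ for the induced inner product and norm on $(1,0)$-vectors (the sesquilinear extension of the Riemannian metric of $\omega$). Let $\Omega\subset\subset M$ be a domain with $C^2$ boundary $b\Omega$ and let $\delta(z)$ be the geodesic distance from $z$ to $b\Omega$. Let $r$ be a normalized defining function of $\Omega$, i.e. a continuous real function on $M$, of class $C^2$ near $b\Omega$, with $r<0$ on $\Omega$, $r>0$ on $M\setminus\overline\Omega$, $C_1\delta\le |r|\le C_2\delta$ near $b\Omega$ for some constants $C_1,C_2>0$, and $\lim_{z\to b\Omega}|r(z)|/\delta(z)=1$. Assume that $r$ has the strong Oka property: there are a constant $K>0$ and a neighborhood $U$ of $b\Omega$ such that $$\partial\bar\partial(-\log(-r))\ge K\omega\quad\text{on } U\cap\Omega \text{ in the sense of distributions,}$$ and let $K(r)\in(0,\infty]$ be the supremum of all such $K$. Let $I(r)$ be the supremum of all $\eta\in(0,1]$ for which there is a neighborhood $U$ of $b\Omega$ with $\partial\bar\partial(-(-r)^\eta)\ge 0$ on $U\cap\Omega$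 in the sense of distributions. For $z\in b\Omega$ let $\mathcal N_z$ be the null space of the Levi form of $b\Omega$ at $z$, i.e. the set of $(1,0)$-vectors $X$ at $z$ with $Xr=0$ and $\partial\bar\partial r(X,\bar Y)=0$ for all $(1,0)$-vectors $Y$ at $z$ with $Yr=0$. Let $W\subset b\Omega$ be the set of weakly pseudoconvex boundary points, i.e. those at which the Levi form is positive semidefinite but not positive definite. Let $L_\nu$ be the unit $(1,0)$-vector with $\partial r(X)=|\partial r|_\omega\langle X,L_\nu\rangle_\omega$ for all $X$. Put $$S(r)=\max\{|\partial\bar\partial r(X,\bar L_\nu)(z)| : z\in W,\ X\in\mathcal N_z,\ |X|_\omega=1\},$$ with $S(r)=0$ if $W=\emptyset$, and $$I_0(r)=\max\Big\{\min\Big\{\frac{K(r)}{8S(r)^2},\ \frac12\Big\},\ 1-\frac{2S(r)^2}{K(r)}\Big\},$$ where $K(r)/(8S(r)^2)=\infty$ if $S(r)=0$ or $K(r)=\infty$, and $2S(r)^2/K(r)=0$ if $K(r)=\infty$. Then $$I(r)\ge I_0(r)>0.$$ -/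

import Mathlib

open Filter MeasureTheory Bundle
open scoped Manifold ContDiff Topology ENNReal Bundle

noncomputable section

namespace DFOka

section Instances

variable {E : Type*} [NormedAddCommGroup E] [NormedSpace ℂ E]
variable {M : Type*} [TopologicalSpace M] [ChartedSpace E M]

/-- A complex manifold (complex analytic transition maps) is a real-analytic manifold. -/
instance realManifold [IsManifold 𝓘(ℂ, E) ω M] : IsManifold 𝓘(ℝ, E) ω M := by
  apply isManifold_of_contDiffOn
  intro e e' he he'
  have h := (contDiffGroupoid ω 𝓘(ℂ, E)).compatible he he'
  exact (((mem_groupoid_of_pregroupoid).1 h).1).restrict_scalars ℝ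

end Instances

/-! ### The complex Hessian in `ℂⁿ` -/

section Flat

variable {E : Type*} [NormedAddCommGroup E] [NormedSpace ℂ E]

/-- The complex Hessian `∂∂̄φ(X, Ȳ) = ∑ φ_{j k̄} X_j Ȳ_k` at `z` of a real function `φ` on a complex
vector space, written through the real second derivative. The vector `X = (X_j)` of `E` stands for
the `(1,0)`-vector `∑ X_j ∂/∂z_j`. -/
def ddbar (φ : E → ℝ) (z X Y : E) : ℂ :=
  let H : E → E → ℝ := fun v w => fderiv ℝ (fderiv ℝ φ) z v w
  (1 / 4 : ℂ) *
    (((H X Y + H (Complex.I • X) (Complex.I • Y) : ℝ) : ℂ) +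
      Complex.I * ((H X (Complex.I • Y) - H (Complex.I • X) Y : ℝ) : ℂ))

end Flat

/-! ### Hermitian manifolds -/

section Manifold

variable {E : Type*} [NormedAddCommGroup E] [NormedSpace ℂ E]
variable {M : Type*} [TopologicalSpace M] [ChartedSpace E M]

/-- The complex structure `J` of the tangent space: multiplication by `i` in a holomorphic chart. -/
def cJ {x : M} (v : TangentSpace 𝓘(ℝ, E) x) : TangentSpace 𝓘(ℝ, E) x :=
  (Complex.I • (show E from v) : E)

/-- The real differential of `r : M → ℝ` at `z`. -/
def dReal (r : M → ℝ) (z : M) : TangentSpace 𝓘(ℝ, E) z →L[ℝ] ℝ :=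
  mfderiv 𝓘(ℝ, E) 𝓘(ℝ, ℝ) r z

/-- The value `X r = ∂r(X)` at `z`. As everywhere below, a real tangent vector `v` stands for
the `(1,0)`-vector `X = (v - i J v) / 2`; in a holomorphic chart, the vector `(X_j)` of the model
space stands for `∑ X_j ∂/∂z_j`. -/
def del (r : M → ℝ) (z : M) (X : TangentSpace 𝓘(ℝ, E) z) : ℂ :=
  (1 / 2 : ℂ) * ((dReal r z X : ℂ) - Complex.I * (dReal r z (cJ X) : ℂ))

/-- `∂∂̄r(X, Ȳ)` at the point `z`, computed in the preferred holomorphic chart at `z`. -/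
def ddbarAt (r : M → ℝ) (z : M) (X Y : TangentSpace 𝓘(ℝ, E) z) : ℂ :=
  ddbar (fun y : E => r ((chartAt E z).symm y)) (chartAt E z z) X Y

variable [RiemannianBundle (fun x : M => TangentSpace 𝓘(ℝ, E) x)]

variable (E M) in
/-- The Riemannian metric is Hermitian: the complex structure acts by isometries. -/
def IsHermitianMetric : Prop :=
  ∀ (x : M) (v w : TangentSpace 𝓘(ℝ, E) x), inner ℝ (cJ v) (cJ w) = inner ℝ v w

/-- The inner product `⟨X, Y⟩_ω` of `(1,0)`-vectors: the sesquilinear extension of the Riemannian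
metric, linear in `X` and conjugate linear in `Y`. -/
def hermInner {x : M} (X Y : TangentSpace 𝓘(ℝ, E) x) : ℂ :=
  (1 / 2 : ℂ) * ((inner ℝ X Y : ℝ) + Complex.I * (inner ℝ X (cJ Y) : ℝ))

/-- `|X|_ω² = ω(X, X̄)` for a `(1,0)`-vector `X`. -/
def normSqω {x : M} (X : TangentSpace 𝓘(ℝ, E) x) : ℝ := (hermInner X X).re

theorem normSqω_eq {x : M} (X : TangentSpace 𝓘(ℝ, E) x) : normSqω X = ‖X‖ ^ 2 / 2 := by
  have h : normSqω X = (1 / 2 : ℝ) * inner ℝ X X := by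
    rw [normSqω, hermInner, show (1 / 2 : ℂ) = ((1 / 2 : ℝ) : ℂ) by norm_num, Complex.re_ofReal_mul]
    simp only [Complex.add_re, Complex.ofReal_re, Complex.mul_re, Complex.I_re, Complex.I_im,
      Complex.ofReal_im, zero_mul, mul_zero, sub_zero, add_zero]
  rw [h, real_inner_self_eq_norm_sq]
  ring

/-- `∂∂̄ f ≥ K ω` on the open set `V` in the sense of distributions: in every holomorphic chart,
for every constant `(1,0)`-vector `X` and every test function `φ ≥ 0` supported in `V`, one has
`∫ f ∂∂̄φ(X, X̄) ≥ ∫ K ω(X, X̄) φ`. -/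
def DdbarGE [FiniteDimensional ℂ E] [MeasurableSpace E] [BorelSpace E]
    (f : M → ℝ) (K : ℝ) (V : Set M) : Prop :=
  ∀ e ∈ IsManifold.maximalAtlas 𝓘(ℂ, E) ω M, ∀ (X : E) (φ : E → ℝ),
    ContDiff ℝ ∞ φ → HasCompactSupport φ → (∀ y, 0 ≤ φ y) →
    tsupport φ ⊆ e.target ∩ e.symm ⁻¹' V →
    ∫ y, K * normSqω (mfderiv 𝓘(ℝ, E) 𝓘(ℝ, E) e.symm y X) * φ y ∂(Measure.addHaar : Measure E) ≤
      ∫ y, f (e.symm y) * (ddbar φ y X X).re ∂(Measure.addHaar : Measure E)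

variable (E) in
/-- The geodesic distance to the boundary of `Ω`. -/
def bdist (Ω : Set M) (z : M) : ℝ≥0∞ := ⨅ p ∈ frontier Ω, Manifold.riemannianEDist 𝓘(ℝ, E) z p

/-! ### Domains and defining functions -/

variable (E) in
/-- `Ω` has `C²` boundary: near each boundary point it is a sublevel set of a `C²` function with
nonvanishing differential. -/
def HasC2Boundary (Ω : Set M) : Prop :=
  ∀ p ∈ frontier Ω, ∃ (U : Set M) (ρ : M → ℝ), IsOpen U ∧ p ∈ U ∧
    ContMDiffOn 𝓘(ℝ, E) 𝓘(ℝ, ℝ) 2 ρ U ∧ (∀ z ∈ U, dReal (E := E) ρ z ≠ 0) ∧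
    Ω ∩ U = {z ∈ U | ρ z < 0}

variable (E) in
/-- `r` is a defining function of `Ω` that is of class `C²` near the boundary. -/
structure IsDefiningFunction (Ω : Set M) (r : M → ℝ) : Prop where
  continuous : Continuous r
  neg : ∀ z ∈ Ω, r z < 0
  pos : ∀ z ∉ closure Ω, 0 < r z
  comparable : ∃ C₁ C₂ : ℝ, 0 < C₁ ∧ 0 < C₂ ∧ ∀ᶠ z in 𝓝ˢ (frontier Ω),
    ENNReal.ofReal C₁ * bdist E Ω z ≤ ENNReal.ofReal |r z| ∧
      ENNReal.ofReal |r z| ≤ ENNReal.ofReal C₂ * bdist E Ω z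
  smooth : ∃ U : Set M, IsOpen U ∧ frontier Ω ⊆ U ∧ ContMDiffOn 𝓘(ℝ, E) 𝓘(ℝ, ℝ) 2 r U

variable (E) in
/-- `|r(z)| / δ(z) → 1` as `z` (off the boundary) tends to the boundary. -/
def IsNormalized (Ω : Set M) (r : M → ℝ) : Prop :=
  Tendsto (fun z => |r z| / (bdist E Ω z).toReal)
    (𝓝ˢ (frontier Ω) ⊓ 𝓟 (frontier Ω)ᶜ) (𝓝 1)

/-! ### The Levi form -/

/-- The null space `𝒩_z` of the Levi form at the boundary point `z`: complex tangential vectors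
`X` (`X r = 0`) that are Levi-orthogonal to all complex tangential vectors. -/
def leviNull (r : M → ℝ) (z : M) : Set (TangentSpace 𝓘(ℝ, E) z) :=
  {X | del r z X = 0 ∧ ∀ Y : TangentSpace 𝓘(ℝ, E) z, del r z Y = 0 → ddbarAt r z X Y = 0}

variable (E) in
/-- The set `W` of weakly pseudoconvex boundary points: the Levi form, on complex tangential
vectors, is positive semidefinite but not positive definite. -/
def weaklyPseudoconvex (Ω : Set M) (r : M → ℝ) : Set M :=
  {z ∈ frontier Ω |
    (∀ X : TangentSpace 𝓘(ℝ, E) z, del r z X = 0 → 0 ≤ (ddbarAt r z X X).re) ∧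
    ∃ X : TangentSpace 𝓘(ℝ, E) z, X ≠ 0 ∧ del r z X = 0 ∧ (ddbarAt r z X X).re = 0}

section Normal

variable [FiniteDimensional ℂ E]

instance (z : M) : FiniteDimensional ℝ (TangentSpace 𝓘(ℝ, E) z) :=
  inferInstanceAs (FiniteDimensional ℝ E)

/-- The Riemannian gradient of `r`; it represents `∂r`, see `hermInner_grad`. -/
def grad (r : M → ℝ) (z : M) : TangentSpace 𝓘(ℝ, E) z :=
  have : CompleteSpace (TangentSpace 𝓘(ℝ, E) z) := FiniteDimensional.complete ℝ _
  (InnerProductSpace.toDual ℝ (TangentSpace 𝓘(ℝ, E) z)).symm (dReal r z)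

theorem inner_grad (r : M → ℝ) (z : M) (v : TangentSpace 𝓘(ℝ, E) z) :
    inner ℝ (grad r z) v = dReal r z v := by
  have : CompleteSpace (TangentSpace 𝓘(ℝ, E) z) := FiniteDimensional.complete ℝ _
  exact InnerProductSpace.toDual_symm_apply

/-- `∂r(X) = ⟨X, grad r⟩_ω`. -/
theorem hermInner_grad (hJ : IsHermitianMetric E M) (r : M → ℝ) (z : M)
    (X : TangentSpace 𝓘(ℝ, E) z) : hermInner X (grad r z) = del r z X := by
  have hJJ : cJ (cJ (grad (E := E) r z)) = -grad r z := by
    change (Complex.I • (Complex.I • (show E from grad r z)) : E) = -(show E from grad r z)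
    rw [smul_smul, Complex.I_mul_I, neg_one_smul]
  have h : inner ℝ X (cJ (grad r z)) = -inner ℝ (grad r z) (cJ X) := by
    rw [← hJ z X, hJJ, inner_neg_right, real_inner_comm]
  have h' : inner ℝ X (grad r z) = inner ℝ (grad r z) X := real_inner_comm _ _
  rw [hermInner, del, h, h', inner_grad, inner_grad]
  rw [Complex.ofReal_neg]
  ring

/-- `L_ν`, the unit vector dual to `ω_ν = ∂r / |∂r|`. -/
def Lν (r : M → ℝ) (z : M) : TangentSpace 𝓘(ℝ, E) z :=
  (Real.sqrt (normSqω (grad (E := E) r z)))⁻¹ • grad r z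

end Normal

/-! ### The indices -/

section Indices

variable [FiniteDimensional ℂ E] [MeasurableSpace E] [BorelSpace E]

variable (E) in
/-- `η` is a Diederich–Fornæss exponent of the defining function `r` of `Ω`. -/
def IsDFExponent (Ω : Set M) (r : M → ℝ) (η : ℝ) : Prop :=
  0 < η ∧ η ≤ 1 ∧ ∃ U : Set M, IsOpen U ∧ frontier Ω ⊆ U ∧
    DdbarGE (E := E) (fun z => -(-r z) ^ η) 0 (U ∩ Ω)

variable (E) in
/-- The Diederich–Fornæss index `I(r)`. -/
def dfIndex (Ω : Set M) (r : M → ℝ) : ℝ≥0∞ :=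
  ⨆ (η : ℝ) (_ : IsDFExponent E Ω r η), ENNReal.ofReal η

variable (E) in
/-- `K > 0` and `∂∂̄(-log(-r)) ≥ K ω` on the part in `Ω` of a neighbourhood of the boundary. -/
def IsOkaConstant (Ω : Set M) (r : M → ℝ) (K : ℝ) : Prop :=
  0 < K ∧ ∃ U : Set M, IsOpen U ∧ frontier Ω ⊆ U ∧
    DdbarGE (E := E) (fun z => -Real.log (-r z)) K (U ∩ Ω)

variable (E) in
/-- The strong Oka property. -/
def StrongOka (Ω : Set M) (r : M → ℝ) : Prop := ∃ K : ℝ, IsOkaConstant E Ω r K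

variable (E) in
/-- The Oka index `K(r)`, possibly `∞`. -/
def okaIndex (Ω : Set M) (r : M → ℝ) : ℝ≥0∞ :=
  ⨆ (K : ℝ) (_ : IsOkaConstant E Ω r K), ENNReal.ofReal K

variable (E) in
/-- `S(r)`: the largest value of `|∂∂̄r(X, L̄_ν)(z)|` for unit vectors `X ∈ 𝒩_z`, `z ∈ W`
(`0` if there are none). -/
def mixedLevi (Ω : Set M) (r : M → ℝ) : ℝ≥0∞ :=
  ⨆ (z : M) (_ : z ∈ weaklyPseudoconvex E Ω r) (X : TangentSpace 𝓘(ℝ, E) z)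
    (_ : X ∈ leviNull r z ∧ normSqω X = 1), ENNReal.ofReal ‖ddbarAt r z X (Lν r z)‖

variable (E) in
/-- `I₀(r) = max {min {K / (8 S²), 1/2}, 1 - 2 S² / K}` with `K = K(r)`, `S = S(r)`. In `[0, ∞]`,
`K / 0 = ∞` for `K ≠ 0` and `S² / ∞ = 0` for `S ≠ ∞`; a negative value of `1 - 2 S² / K` is cut off
at `0`, which does not change the maximum. -/
def I₀ (Ω : Set M) (r : M → ℝ) : ℝ≥0∞ :=
  max (min (okaIndex E Ω r / (8 * mixedLevi E Ω r ^ 2)) (1 / 2))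
    (1 - 2 * mixedLevi E Ω r ^ 2 / okaIndex E Ω r)

end Indices

end Manifold

end DFOka

end

/-!
Let `ρ = -r`. Off the boundary and near it, `r` is of class `C²`, so that the inequalities between
currents are pointwise ones: integrate by parts twice in one direction (`integral_mul_ddbar`) and
test with bump functions in the other (`le_ddbar_of_forall_test`). As

* `∂∂̄(-log ρ) = ∂∂̄r / ρ + ∂r ∧ ∂̄r / ρ²` and
* `∂∂̄(-ρ^η) = η ρ^(η - 2) (ρ ∂∂̄r + (1 - η) ∂r ∧ ∂̄r)`,

the strong Oka property bounds `ρ ∂∂̄r + ∂r ∧ ∂̄r` below by `K ρ² ω`, and the claim is that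
`ρ ∂∂̄r + (1 - η) ∂r ∧ ∂̄r` is nonnegative near the boundary. Fix a boundary point `p`, work in a
holomorphic chart at `p`, let `L` be the constant vector that equals `L_ν` at `p`, and decompose
`X = a L + T` with `∂r(T) = 0`. The Oka inequality for `T` gives `∂∂̄r(T, T̄) ≥ K ρ |T|²`; at the
boundary this says that the Levi form is positive semidefinite (`OkaAt.levi_nonneg`). By compactness
of the unit sphere,

`|∂∂̄r(T, L̄)|² ≤ S'² |T|² + C ∂∂̄r(T, T̄)` near `p`, for every `S' > S(r)`

(`OkaAt.mixed_bound`): in null directions of the Levi form this is the definition of `S(r)`, in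
other directions the last term dominates. Use the Oka inequality for `X` with weight `1 - τ`, and expand
`ρ ∂∂̄r(X, X̄)` with weight `τ`. In the latter, the mixed term is absorbed at the cost of a fraction
`s` of `|∂r(X)|²` and of `ρ² S'² |T|² / (s |∂r(L)|²)` (`nonneg_of_bounds`). Since `|∂r(L)|² ≥ 1 / 2`
at `p`, what remains is nonnegative near `p` if `η < τ (1 - s)` and `τ S² < K s / 2`
(`OkaAt.eventually_df_inequality`). The choice `τ = 1` leads to `η < 1 - 2 S² / K`, the choice
`s = 1 / 2` to `η < min (K / (8 S²)) (1 / 2)` (`exists_weights`).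

The lower bound for `|∂r(L)|² = |dr|² / 2` comes from the normalization `|r| / δ → 1`: if `|dr| < 1`
at `p`, short paths to the boundary show that `|r| ≤ c δ` near `p` for some `c < 1`
(`one_le_norm_grad`). The estimates are made in the preferred charts of boundary points, and the
invariance of the complex Hessian under holomorphic maps (`ddbar_comp_holomorphic`) carries them to
all charts; it also shows, together with the compactness of the boundary, that `S(r)` is finite
(`mixedLevi_ne_top`), hence that `I₀(r)` is positive.
-/

noncomputable section

namespace DFOka

/-! ### Levi forms of real bilinear forms -/

section Levi

variable {E : Type*} [NormedAddCommGroup E] [NormedSpace ℂ E]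

/-- The Hermitian form attached to a real bilinear form `H` on a complex vector space, normalized
such that `ddbar φ z` is the Levi form of the real Hessian of `φ` at `z`. -/
def leviForm (H : E →L[ℝ] E →L[ℝ] ℝ) (X Y : E) : ℂ :=
  (1 / 4 : ℂ) *
    (((H X Y + H (Complex.I • X) (Complex.I • Y) : ℝ) : ℂ) +
      Complex.I * ((H X (Complex.I • Y) - H (Complex.I • X) Y : ℝ) : ℂ))

/-- The complex linear form `∂r(X) = (dr(X) - i dr(iX)) / 2` attached to a real one. -/
def delForm (l : E →L[ℝ] ℝ) (X : E) : ℂ :=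
  (1 / 2 : ℂ) * ((l X : ℂ) - Complex.I * (l (Complex.I • X) : ℂ))

theorem ddbar_eq_leviForm (φ : E → ℝ) (z X Y : E) :
    ddbar φ z X Y = leviForm (fderiv ℝ (fderiv ℝ φ) z) X Y := rfl

theorem I_smul_I_smul (X : E) : Complex.I • Complex.I • X = -X := by
  rw [smul_smul, Complex.I_mul_I, neg_one_smul]

theorem complex_smul_eq (a : ℂ) (X : E) : a • X = a.re • X + a.im • Complex.I • X := by
  conv_lhs => rw [← Complex.re_add_im a]
  rw [add_smul, mul_smul, Complex.coe_smul, Complex.coe_smul]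

variable (H : E →L[ℝ] E →L[ℝ] ℝ) (l : E →L[ℝ] ℝ)

theorem leviForm_add_left (X X' Y : E) :
    leviForm H (X + X') Y = leviForm H X Y + leviForm H X' Y := by
  simp only [leviForm, smul_add, map_add, add_apply]
  push_cast
  ring

theorem leviForm_smul_left (a : ℂ) (X Y : E) : leviForm H (a • X) Y = a * leviForm H X Y := by
  have h : Complex.I • a • X = a.re • Complex.I • X - a.im • X := by
    rw [smul_comm, complex_smul_eq a, I_smul_I_smul, smul_neg, sub_eq_add_neg]
  rw [leviForm, h, complex_smul_eq a]
  simp only [leviForm, map_add, map_sub, map_smul, add_apply,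
    sub_apply, smul_apply, smul_eq_mul]
  apply Complex.ext <;> simp <;> ring

theorem leviForm_conj_symm (hH : ∀ v w, H v w = H w v) (X Y : E) :
    leviForm H X Y = (starRingEnd ℂ) (leviForm H Y X) := by
  simp only [leviForm, hH Y X, hH (Complex.I • Y) (Complex.I • X), hH Y (Complex.I • X),
    hH (Complex.I • Y) X]
  apply Complex.ext <;> simp

theorem leviForm_self_re (X : E) :
    (leviForm H X X).re = (H X X + H (Complex.I • X) (Complex.I • X)) / 4 := by
  simp [leviForm]
  ring

theorem leviForm_self_re_smul (hH : ∀ v w, H v w = H w v) (a : ℂ) (X : E) :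
    (leviForm H (a • X) (a • X)).re = ‖a‖ ^ 2 * (leviForm H X X).re := by
  rw [leviForm_smul_left, leviForm_conj_symm H hH X, leviForm_smul_left,
    leviForm_conj_symm H hH X X, ← Complex.normSq_eq_norm_sq]
  simp only [map_mul, Complex.conj_conj]
  rw [← mul_assoc, Complex.mul_conj]
  simp

theorem leviForm_self_re_add (hH : ∀ v w, H v w = H w v) (X Y : E) :
    (leviForm H (X + Y) (X + Y)).re =
      (leviForm H X X).re + 2 * (leviForm H X Y).re + (leviForm H Y Y).re := by
  rw [leviForm_add_left, leviForm_conj_symm H hH X (X + Y), leviForm_conj_symm H hH Y (X + Y),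
    leviForm_add_left, leviForm_add_left, leviForm_conj_symm H hH Y X]
  simp
  ring

theorem norm_leviForm_le (X Y : E) : ‖leviForm H X Y‖ ≤ ‖H‖ * ‖X‖ * ‖Y‖ := by
  have hb : ∀ v w : E, ‖v‖ = ‖X‖ → ‖w‖ = ‖Y‖ → |H v w| ≤ ‖H‖ * ‖X‖ * ‖Y‖ := by
    intro v w hv hw
    have := H.le_opNorm₂ v w
    rwa [hv, hw, Real.norm_eq_abs] at this
  have hX : ‖Complex.I • X‖ = ‖X‖ := by rw [norm_smul]; simp
  have hY : ‖Complex.I • Y‖ = ‖Y‖ := by rw [norm_smul]; simp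
  have h1 := hb X Y rfl rfl
  have h2 := hb _ _ hX hY
  have h3 := hb X _ rfl hY
  have h4 := hb _ Y hX rfl
  rw [leviForm, norm_mul]
  have h5 : ‖(((H X Y + H (Complex.I • X) (Complex.I • Y) : ℝ) : ℂ) +
      Complex.I * ((H X (Complex.I • Y) - H (Complex.I • X) Y : ℝ) : ℂ))‖
      ≤ |H X Y + H (Complex.I • X) (Complex.I • Y)|
        + |H X (Complex.I • Y) - H (Complex.I • X) Y| := by
    refine (norm_add_le _ _).trans ?_
    rw [norm_mul, Complex.norm_I, one_mul, Complex.norm_real, Complex.norm_real,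
      Real.norm_eq_abs, Real.norm_eq_abs]
  have h6 : ‖(1 / 4 : ℂ)‖ = 1 / 4 := by norm_num
  rw [h6]
  have h7 := abs_add_le (H X Y) (H (Complex.I • X) (Complex.I • Y))
  have h8 := abs_sub (H X (Complex.I • Y)) (H (Complex.I • X) Y)
  linarith

theorem delForm_add (X Y : E) : delForm l (X + Y) = delForm l X + delForm l Y := by
  simp only [delForm, smul_add, map_add]
  push_cast
  ring

theorem delForm_smul (a : ℂ) (X : E) : delForm l (a • X) = a * delForm l X := by
  have h : Complex.I • a • X = a.re • Complex.I • X - a.im • X := by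
    rw [smul_comm, complex_smul_eq a, I_smul_I_smul, smul_neg, sub_eq_add_neg]
  rw [delForm, h, complex_smul_eq a]
  simp only [delForm, map_add, map_sub, map_smul, smul_eq_mul]
  apply Complex.ext <;> simp <;> ring

theorem norm_delForm_sq (X : E) :
    ‖delForm l X‖ ^ 2 = (l X ^ 2 + l (Complex.I • X) ^ 2) / 4 := by
  rw [← Complex.normSq_eq_norm_sq, Complex.normSq_apply]
  simp [delForm]
  ring

/-- In a positive semidefinite Hermitian form, an isotropic vector lies in the null space. Here the
form is only assumed to be semidefinite on the kernel of `∂r`. -/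
theorem leviForm_eq_zero_of_isotropic (hH : ∀ v w, H v w = H w v)
    (hpos : ∀ X, delForm l X = 0 → 0 ≤ (leviForm H X X).re) {T : E} (hT : delForm l T = 0)
    (hq : (leviForm H T T).re = 0) {Y : E} (hY : delForm l Y = 0) : leviForm H T Y = 0 := by
  by_contra hne
  set c := leviForm H T Y with hc
  have hc0 : 0 < ‖c‖ ^ 2 := by positivity
  have key : ∀ t : ℝ, 0 ≤ 2 * t * ‖c‖ ^ 2 + (leviForm H Y Y).re := by
    intro t
    have h := hpos (((t : ℂ) * (starRingEnd ℂ) c) • T + Y)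
      (by rw [delForm_add, delForm_smul, hT, hY]; simp)
    rw [leviForm_self_re_add H hH, leviForm_self_re_smul H hH, hq, leviForm_smul_left, ← hc,
      mul_assoc, ← Complex.normSq_eq_conj_mul_self, ← Complex.ofReal_mul, Complex.ofReal_re,
      Complex.normSq_eq_norm_sq] at h
    linarith
  have h := key (-((leviForm H Y Y).re + 1) / (2 * ‖c‖ ^ 2))
  have h2 : 2 * (-((leviForm H Y Y).re + 1) / (2 * ‖c‖ ^ 2)) * ‖c‖ ^ 2 =
      -((leviForm H Y Y).re + 1) := by
    field_simp
  linarith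

end Levi

/-! ### Chain rules for the complex Hessian -/

section Chain

variable {E : Type*} [NormedAddCommGroup E] [NormedSpace ℂ E]

theorem ddbar_congr {f g : E → ℝ} {y : E} (h : f =ᶠ[𝓝 y] g) (X Y : E) :
    ddbar f y X Y = ddbar g y X Y := by
  rw [ddbar_eq_leviForm, ddbar_eq_leviForm, (h.fderiv (𝕜 := ℝ)).fderiv_eq]

theorem fderiv_fderiv_symm {u : E → ℝ} {y : E} (hu : ContDiffAt ℝ 2 u y) (v w : E) :
    fderiv ℝ (fderiv ℝ u) y v w = fderiv ℝ (fderiv ℝ u) y w v :=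
  (hu.isSymmSndFDerivAt (by simp)).eq v w

theorem differentiableAt_fderiv {u : E → ℝ} {y : E} (hu : ContDiffAt ℝ 2 u y) :
    DifferentiableAt ℝ (fderiv ℝ u) y :=
  (hu.fderiv_right (m := 1) (by norm_num)).differentiableAt (by norm_num)

theorem eventually_differentiableAt {F : Type*} [NormedAddCommGroup F] [NormedSpace ℝ F]
    {u : E → F} {y : E} (hu : ContDiffAt ℝ 2 u y) :
    ∀ᶠ x in 𝓝 y, DifferentiableAt ℝ u x := by
  filter_upwards [hu.eventually (by simp)] with x hx using hx.differentiableAt (by norm_num)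

/-- The complex Hessian of `φ ∘ u` for a function `φ` of one real variable. -/
theorem ddbar_comp_re {u : E → ℝ} {y : E} (hu : ContDiffAt ℝ 2 u y) {φ φ' : ℝ → ℝ} {φ'' : ℝ}
    (hφ : ∀ᶠ t in 𝓝 (u y), HasDerivAt φ (φ' t) t) (hφ' : HasDerivAt φ' φ'' (u y)) (X : E) :
    (ddbar (fun x => φ (u x)) y X X).re =
      φ' (u y) * (ddbar u y X X).re + φ'' * ‖delForm (fderiv ℝ u y) X‖ ^ 2 := by
  have h1 : fderiv ℝ (fun x => φ (u x)) =ᶠ[𝓝 y] fun x => φ' (u x) • fderiv ℝ u x := by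
    filter_upwards [eventually_differentiableAt hu, hu.continuousAt.eventually hφ] with x hx hx'
    exact (hx'.comp_hasFDerivAt x hx.hasFDerivAt).fderiv
  have h2 : HasFDerivAt (fun x => φ' (u x)) (φ'' • fderiv ℝ u y) y :=
    hφ'.comp_hasFDerivAt y (hu.differentiableAt (by norm_num)).hasFDerivAt
  have h3 := h2.smul (differentiableAt_fderiv hu).hasFDerivAt
  have h4 : ∀ v : E, fderiv ℝ (fderiv ℝ (fun x => φ (u x))) y v v =
      φ' (u y) * fderiv ℝ (fderiv ℝ u) y v v + φ'' * fderiv ℝ u y v ^ 2 := by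
    intro v
    rw [(h3.congr_of_eventuallyEq h1).fderiv]
    simp
    ring
  rw [ddbar_eq_leviForm, ddbar_eq_leviForm, leviForm_self_re, leviForm_self_re, norm_delForm_sq,
    h4, h4]
  ring

/-- The complex Hessian is invariant under holomorphic changes of coordinates. -/
theorem ddbar_comp_holomorphic {g : E → E} {y : E} (hg : ContDiffAt ℂ 2 g y) {f : E → ℝ}
    (hf : ContDiffAt ℝ 2 f (g y)) (X Y : E) :
    ddbar (fun x => f (g x)) y X Y = ddbar f (g y) (fderiv ℝ g y X) (fderiv ℝ g y Y) := by
  have hgR : ContDiffAt ℝ 2 g y := hg.restrict_scalars ℝ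
  have hlin : ∀ᶠ x in 𝓝 y, ∀ w : E,
      fderiv ℝ g x (Complex.I • w) = Complex.I • fderiv ℝ g x w := by
    filter_upwards [hg.eventually (by simp)] with x hx w
    rw [(hx.differentiableAt (by norm_num)).fderiv_restrictScalars ℝ]
    simp
  have hd : DifferentiableAt ℝ (fderiv ℝ g) y :=
    (hgR.fderiv_right (m := 1) (by norm_num)).differentiableAt (by norm_num)
  set D := fderiv ℝ (fderiv ℝ g) y with hD
  have hsymm : ∀ v w, D v w = D w v := fun v w => (hgR.isSymmSndFDerivAt (by simp)).eq v w
  have hDI : ∀ v w, D v (Complex.I • w) = Complex.I • D v w := by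
    intro v w
    have h1 : HasFDerivAt (fun x => fderiv ℝ g x (Complex.I • w)) (D.flip (Complex.I • w)) y := by
      simpa using hd.hasFDerivAt.clm_apply (hasFDerivAt_const (Complex.I • w) y)
    have h2 : HasFDerivAt (fun x => fderiv ℝ g x w) (D.flip w) y := by
      simpa using hd.hasFDerivAt.clm_apply (hasFDerivAt_const w y)
    have h3 := h2.const_smul Complex.I
    have h4 : (fun x => fderiv ℝ g x (Complex.I • w)) =ᶠ[𝓝 y]
        fun x => Complex.I • fderiv ℝ g x w := by
      filter_upwards [hlin] with x hx using hx w
    have h5 := (h3.congr_of_eventuallyEq h4).unique h1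
    have h6 := congrArg (fun A : E →L[ℝ] E => A v) h5
    simpa using h6.symm
  have hDI' : ∀ v w, D (Complex.I • v) w = Complex.I • D v w := by
    intro v w
    rw [hsymm, hDI, hsymm]
  have h1 : fderiv ℝ (fun x => f (g x)) =ᶠ[𝓝 y]
      fun x => (fderiv ℝ f (g x)).comp (fderiv ℝ g x) := by
    filter_upwards [eventually_differentiableAt hgR,
      hgR.continuousAt.eventually (eventually_differentiableAt hf)] with x hx hx'
    exact fderiv_comp x hx' hx
  have h2 : HasFDerivAt (fun x => fderiv ℝ f (g x))
      ((fderiv ℝ (fderiv ℝ f) (g y)).comp (fderiv ℝ g y)) y :=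
    (differentiableAt_fderiv hf).hasFDerivAt.comp y
      (hgR.differentiableAt (by norm_num)).hasFDerivAt
  have h3 := h2.clm_comp hd.hasFDerivAt
  have h4 : ∀ v w : E, fderiv ℝ (fderiv ℝ (fun x => f (g x))) y v w =
      fderiv ℝ (fderiv ℝ f) (g y) (fderiv ℝ g y v) (fderiv ℝ g y w)
        + fderiv ℝ f (g y) (D v w) := by
    intro v w
    rw [h1.fderiv_eq, h3.fderiv]
    simp [← hD]
    ring
  have hI := hlin.self_of_nhds
  rw [ddbar_eq_leviForm, ddbar_eq_leviForm, leviForm, leviForm]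
  simp only [h4, hI, hDI, hDI', I_smul_I_smul, map_neg]
  congr 2
  · congr 1
    ring
  · congr 2
    ring

end Chain

/-! ### Distributional and pointwise inequalities -/

section Distributions

variable {E : Type*} [NormedAddCommGroup E] [NormedSpace ℂ E]

theorem continuous_mul_of_tsupport_subset {Y : Type*} [TopologicalSpace Y] {V : Set Y}
    (hV : IsOpen V) {f g : Y → ℝ}
    (hf : ContinuousOn f V) (hg : Continuous g) (h : tsupport g ⊆ V) :
    Continuous fun y => f y * g y := by
  refine continuous_of_tsupport fun y hy => ?_
  have hyV : y ∈ V := h (tsupport_mul_subset_right hy)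
  exact (hf.continuousAt (hV.mem_nhds hyV)).mul hg.continuousAt

theorem continuousAt_hessian {f : E → ℝ} {y : E} (hf : ContDiffAt ℝ 2 f y) :
    ContinuousAt (fderiv ℝ (fderiv ℝ f)) y :=
  ((hf.fderiv_right (m := 1) (by norm_num)).fderiv_right (m := 0) (by norm_num)).continuousAt

theorem continuousAt_ddbar_re {f : E → ℝ} {y : E} (hf : ContDiffAt ℝ 2 f y) (X : E) :
    ContinuousAt (fun x => (ddbar f x X X).re) y := by
  simp only [ddbar_eq_leviForm, leviForm_self_re]
  have h := continuousAt_hessian hf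
  fun_prop

variable [FiniteDimensional ℂ E] [MeasurableSpace E] [BorelSpace E]

theorem integrable_mul_of_tsupport_subset {V : Set E} (hV : IsOpen V) {f g : E → ℝ}
    (hf : ContinuousOn f V) (hg : Continuous g) (hc : HasCompactSupport g) (h : tsupport g ⊆ V) :
    Integrable (fun y => f y * g y) (Measure.addHaar : Measure E) :=
  (continuous_mul_of_tsupport_subset hV hf hg h).integrable_of_hasCompactSupport hc.mul_left

theorem integral_mul_fderiv_of_tsupport_subset {V : Set E} (hV : IsOpen V) {f g : E → ℝ}
    (hf : ∀ y ∈ V, ContDiffAt ℝ 1 f y) (hg : ContDiff ℝ 1 g) (hc : HasCompactSupport g)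
    (h : tsupport g ⊆ V) (v : E) :
    ∫ y, f y * fderiv ℝ g y v ∂(Measure.addHaar : Measure E) =
      -∫ y, fderiv ℝ f y v * g y ∂(Measure.addHaar : Measure E) := by
  have hf0 : ContinuousOn f V := fun y hy => (hf y hy).continuousAt.continuousWithinAt
  have hf1 : ContinuousOn (fun y => fderiv ℝ f y v) V := fun y hy =>
    (((hf y hy).fderiv_right (m := 0) (by norm_num)).continuousAt.clm_apply
      continuousAt_const).continuousWithinAt
  have hs : tsupport (fun y => fderiv ℝ g y v) ⊆ tsupport g := tsupport_fderiv_apply_subset ℝ v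
  have hg1 : Continuous fun y => fderiv ℝ g y v :=
    (hg.continuous_fderiv (by norm_num)).clm_apply continuous_const
  refine integral_mul_fderiv_eq_neg_fderiv_mul_of_integrable ?_ ?_ ?_ ?_ ?_
  · exact integrable_mul_of_tsupport_subset hV hf1 hg.continuous hc h
  · exact integrable_mul_of_tsupport_subset hV hf0 hg1 (hc.fderiv_apply (𝕜 := ℝ) v) (hs.trans h)
  · exact integrable_mul_of_tsupport_subset hV hf0 hg.continuous hc h
  · exact fun y hy => (hf y (h hy)).differentiableAt (by norm_num)
  · exact fun y _ => hg.differentiable (by norm_num) y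

/-- The complex Hessian may be moved from a test function to a function of class `C²`. -/
theorem integral_mul_ddbar {V : Set E} (hV : IsOpen V) {f φ : E → ℝ}
    (hf : ∀ y ∈ V, ContDiffAt ℝ 2 f y) (hφ : ContDiff ℝ ∞ φ) (hc : HasCompactSupport φ)
    (h : tsupport φ ⊆ V) (X : E) :
    ∫ y, f y * (ddbar φ y X X).re ∂(Measure.addHaar : Measure E) =
      ∫ y, (ddbar f y X X).re * φ y ∂(Measure.addHaar : Measure E) := by
  have happ : ∀ {g : E → ℝ} {y : E} (v : E), ContDiffAt ℝ 2 g y →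
      fderiv ℝ (fderiv ℝ g) y v v = fderiv ℝ (fun x => fderiv ℝ g x v) y v := by
    intro g y v hg
    have h1 := (differentiableAt_fderiv hg).hasFDerivAt.clm_apply (hasFDerivAt_const v y)
    rw [h1.fderiv]
    simp
  have hφ2 : ContDiff ℝ 2 φ := by exact_mod_cast contDiff_infty.1 hφ 2
  have hf' : ∀ v, ∀ y ∈ V, ContDiffAt ℝ 1 (fun x => fderiv ℝ f x v) y := fun v y hy =>
    ((hf y hy).fderiv_right (m := 1) (by norm_num)).clm_apply contDiffAt_const
  have hφ' : ∀ v, ContDiff ℝ 1 (fun x => fderiv ℝ φ x v) := fun v =>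
    (hφ2.fderiv_right (m := 1) (by norm_num)).clm_apply contDiff_const
  have hs : ∀ v, tsupport (fun y => fderiv ℝ φ y v) ⊆ V := fun v =>
    (tsupport_fderiv_apply_subset ℝ v).trans h
  have hcs : ∀ v, HasCompactSupport (fun y => fderiv ℝ φ y v) := fun v => hc.fderiv_apply (𝕜 := ℝ) v
  have hf0 : ContinuousOn f V := fun y hy => (hf y hy).continuousAt.continuousWithinAt
  have key : ∀ v : E,
      ∫ y, f y * fderiv ℝ (fderiv ℝ φ) y v v ∂(Measure.addHaar : Measure E) =
        ∫ y, fderiv ℝ (fderiv ℝ f) y v v * φ y ∂(Measure.addHaar : Measure E) := by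
    intro v
    have h1 := integral_mul_fderiv_of_tsupport_subset hV
      (fun y hy => (hf y hy).of_le (by norm_num)) (hφ' v) (hcs v) (hs v) v
    have h2 := integral_mul_fderiv_of_tsupport_subset hV (hf' v)
      (hφ2.of_le (by norm_num)) hc h v
    simp only [happ v hφ2.contDiffAt]
    rw [h1, h2, neg_neg]
    refine integral_congr_ae (Eventually.of_forall fun y => ?_)
    by_cases hy : y ∈ V
    · simp only [happ v (hf y hy)]
    · have : φ y = 0 := image_eq_zero_of_notMem_tsupport fun hy' => hy (h hy')
      simp only [this, mul_zero]
  have hi1 : ∀ v : E, Integrable (fun y => f y * fderiv ℝ (fderiv ℝ φ) y v v)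
      (Measure.addHaar : Measure E) := by
    intro v
    simp only [happ v hφ2.contDiffAt]
    exact integrable_mul_of_tsupport_subset hV hf0
      (((hφ' v).continuous_fderiv (by norm_num)).clm_apply continuous_const)
      ((hcs v).fderiv_apply (𝕜 := ℝ) v) ((tsupport_fderiv_apply_subset ℝ v).trans (hs v))
  have hi2 : ∀ v : E, Integrable (fun y => fderiv ℝ (fderiv ℝ f) y v v * φ y)
      (Measure.addHaar : Measure E) := fun v =>
    integrable_mul_of_tsupport_subset hV (fun y hy =>
      (((continuousAt_hessian (hf y hy)).clm_apply continuousAt_const).clm_apply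
        continuousAt_const).continuousWithinAt) hφ.continuous hc h
  simp only [ddbar_eq_leviForm, leviForm_self_re, mul_div_assoc', mul_add, add_div, add_mul,
    div_mul_eq_mul_div]
  rw [integral_add ((hi1 X).div_const 4) ((hi1 _).div_const 4),
    integral_add ((hi2 X).div_const 4) ((hi2 _).div_const 4), integral_div, integral_div,
    integral_div, integral_div, key, key]

/-- A lower bound of the complex Hessian that holds in the sense of distributions holds pointwise,
if both sides are continuous. -/
theorem le_ddbar_of_forall_test {V : Set E} (hV : IsOpen V) {f N : E → ℝ} {X : E}
    (hf : ∀ y ∈ V, ContDiffAt ℝ 2 f y) (hN : ContinuousOn N V)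
    (h : ∀ φ : E → ℝ, ContDiff ℝ ∞ φ → HasCompactSupport φ → (∀ y, 0 ≤ φ y) → tsupport φ ⊆ V →
      ∫ y, N y * φ y ∂(Measure.addHaar : Measure E) ≤
        ∫ y, f y * (ddbar φ y X X).re ∂(Measure.addHaar : Measure E)) :
    ∀ y ∈ V, N y ≤ (ddbar f y X X).re := by
  intro y₀ hy₀
  by_contra! hlt
  have hD : ContinuousOn (fun y => (ddbar f y X X).re) V := fun y hy =>
    (continuousAt_ddbar_re (hf y hy) X).continuousWithinAt
  have hnear : ∀ᶠ y in 𝓝 y₀, y ∈ V ∧ (ddbar f y X X).re < N y :=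
    Filter.Eventually.and (hV.mem_nhds hy₀) ((hD.continuousAt (hV.mem_nhds hy₀)).eventually_lt
      (hN.continuousAt (hV.mem_nhds hy₀)) hlt)
  obtain ⟨ε, hε, hball⟩ := Metric.eventually_nhds_iff_ball.1 hnear
  let φ : ContDiffBump y₀ := ⟨ε / 4, ε / 2, by linarith, by linarith⟩
  have hsupp : tsupport φ ⊆ Metric.ball y₀ ε := by
    rw [φ.tsupport_eq]
    exact Metric.closedBall_subset_ball (by change ε / 2 < ε; linarith)
  have hsV : tsupport φ ⊆ V := fun y hy => (hball y (hsupp hy)).1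
  have hle := h φ φ.contDiff φ.hasCompactSupport (fun y => φ.nonneg) hsV
  rw [integral_mul_ddbar hV hf φ.contDiff φ.hasCompactSupport hsV] at hle
  have hI1 := integrable_mul_of_tsupport_subset hV hN φ.continuous φ.hasCompactSupport hsV
  have hI2 := integrable_mul_of_tsupport_subset hV hD φ.continuous φ.hasCompactSupport hsV
  have hpos : 0 < ∫ y, (N y - (ddbar f y X X).re) * φ y ∂(Measure.addHaar : Measure E) := by
    refine (continuous_mul_of_tsupport_subset hV (hN.sub hD) φ.continuous
      hsV).integral_pos_of_hasCompactSupport_nonneg_nonzero (x := y₀)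
      φ.hasCompactSupport.mul_left ?_ ?_
    · intro y
      by_cases hy : y ∈ tsupport φ
      · exact mul_nonneg (sub_nonneg.2 (hball y (hsupp hy)).2.le) φ.nonneg
      · simp [image_eq_zero_of_notMem_tsupport hy]
    · have : φ y₀ = 1 := φ.one_of_mem_closedBall (Metric.mem_closedBall_self φ.rIn_pos.le)
      rw [this, mul_one]
      exact (sub_pos.2 hlt).ne'
  simp only [sub_mul] at hpos
  rw [integral_sub hI1 hI2] at hpos
  linarith

theorem integral_mul_ddbar_nonneg {V : Set E} (hV : IsOpen V) {f φ : E → ℝ} {X : E}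
    (hf : ∀ y ∈ V, ContDiffAt ℝ 2 f y) (hpos : ∀ y ∈ V, 0 ≤ (ddbar f y X X).re)
    (hφ : ContDiff ℝ ∞ φ) (hc : HasCompactSupport φ) (hφ0 : ∀ y, 0 ≤ φ y) (h : tsupport φ ⊆ V) :
    0 ≤ ∫ y, f y * (ddbar φ y X X).re ∂(Measure.addHaar : Measure E) := by
  rw [integral_mul_ddbar hV hf hφ hc h]
  refine integral_nonneg fun y => ?_
  by_cases hy : y ∈ tsupport φ
  · exact mul_nonneg (hpos y (h hy)) (hφ0 y)
  · simp [image_eq_zero_of_notMem_tsupport hy]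

end Distributions

/-! ### The pointwise estimate near a boundary point -/

section Local

variable {E : Type*} [NormedAddCommGroup E] [NormedSpace ℂ E]

theorem continuousAt_ddbar {u : E → ℝ} {x₀ : E} (hu : ContDiffAt ℝ 2 u x₀) (X Y : E) :
    ContinuousAt (fun z : E × E × E => ddbar u z.1 z.2.1 z.2.2) (x₀, X, Y) := by
  simp only [ddbar_eq_leviForm, leviForm]
  have h : ContinuousAt (fun z : E × E × E => fderiv ℝ (fderiv ℝ u) z.1) (x₀, X, Y) :=
    ContinuousAt.comp (f := fun z : E × E × E => z.1) (continuousAt_hessian hu) continuousAt_fst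
  fun_prop

theorem continuousAt_delForm {u : E → ℝ} {x₀ : E} (hu : ContDiffAt ℝ 2 u x₀) (X : E) :
    ContinuousAt (fun z : E × E => delForm (fderiv ℝ u z.1) z.2) (x₀, X) := by
  simp only [delForm]
  have h : ContinuousAt (fun z : E × E => fderiv ℝ u z.1) (x₀, X) :=
    ContinuousAt.comp (f := fun z : E × E => z.1)
      (differentiableAt_fderiv hu).continuousAt continuousAt_fst
  fun_prop

theorem continuousAt_ddbar_self_re {u : E → ℝ} {x₀ : E} (hu : ContDiffAt ℝ 2 u x₀) (X : E) :
    ContinuousAt (fun z : E × E => (ddbar u z.1 z.2 z.2).re) (x₀, X) := by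
  have h : ContinuousAt (fun z : E × E => (z.1, z.2, z.2)) (x₀, X) := by fun_prop
  exact Complex.continuous_re.continuousAt.comp
    (ContinuousAt.comp (x := (x₀, X)) (g := fun z : E × E × E => ddbar u z.1 z.2.1 z.2.2)
      (f := fun z : E × E => (z.1, z.2, z.2)) (continuousAt_ddbar hu X X) h)

theorem continuousAt_ddbar_left {u : E → ℝ} {x₀ : E} (hu : ContDiffAt ℝ 2 u x₀) (X Y : E) :
    ContinuousAt (fun z : E × E => ddbar u z.1 z.2 Y) (x₀, X) := by
  have h : ContinuousAt (fun z : E × E => (z.1, z.2, Y)) (x₀, X) := by fun_prop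
  exact ContinuousAt.comp (x := (x₀, X)) (g := fun z : E × E × E => ddbar u z.1 z.2.1 z.2.2)
    (f := fun z : E × E => (z.1, z.2, Y)) (continuousAt_ddbar hu X Y) h

theorem eventually_norm_hessian_lt {u : E → ℝ} {x₀ : E} (hu : ContDiffAt ℝ 2 u x₀) :
    ∀ᶠ y in 𝓝 x₀, ‖fderiv ℝ (fderiv ℝ u) y‖ < ‖fderiv ℝ (fderiv ℝ u) x₀‖ + 1 :=
  ((continuous_norm (E := E →L[ℝ] E →L[ℝ] ℝ)).continuousAt.comp
    (continuousAt_hessian hu)).eventually (gt_mem_nhds (lt_add_one _))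

/-- A family of norms on a finite-dimensional space that depends continuously on a parameter is
locally uniformly equivalent to the given norm. -/
theorem exists_norm_equiv [FiniteDimensional ℂ E] {n : E → Seminorm ℝ E} {x₀ : E}
    (hn : ∀ X, ContinuousAt (fun z : E × E => n z.1 z.2) (x₀, X))
    (hpos : ∀ X, X ≠ 0 → 0 < n x₀ X) :
    ∃ c B : ℝ, 0 < c ∧ 0 ≤ B ∧ ∀ᶠ y in 𝓝 x₀, ∀ X, c * ‖X‖ ≤ n y X ∧ n y X ≤ B * ‖X‖ := by
  have : ProperSpace E := FiniteDimensional.proper ℂ E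
  have hK : IsCompact (Metric.sphere (0 : E) 1) := isCompact_sphere 0 1
  have hcont : ContinuousOn (n x₀) (Metric.sphere (0 : E) 1) := fun X _ =>
    (ContinuousAt.comp (f := fun X : E => (x₀, X)) (hn X) (by fun_prop)).continuousWithinAt
  obtain ⟨c, hc, hc'⟩ : ∃ c > 0, ∀ X ∈ Metric.sphere (0 : E) 1, c < n x₀ X := by
    rcases (Metric.sphere (0 : E) 1).eq_empty_or_nonempty with he | hne
    · exact ⟨1, one_pos, fun X hX => by simp [he] at hX⟩
    · obtain ⟨X, hX, hmin⟩ := hK.exists_isMinOn hne hcont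
      have hX0 : X ≠ 0 := ne_zero_of_mem_unit_sphere ⟨X, hX⟩
      refine ⟨n x₀ X / 2, half_pos (hpos X hX0), fun Y hY => ?_⟩
      have h1 : n x₀ X ≤ n x₀ Y := hmin hY
      linarith [hpos X hX0]
  obtain ⟨B, hB⟩ := hK.exists_bound_of_continuousOn hcont
  have hev : ∀ᶠ y in 𝓝 x₀, ∀ X ∈ Metric.sphere (0 : E) 1,
      c < n y X ∧ n y X < max B 0 + 1 := by
    refine hK.eventually_forall_of_forall_eventually fun X hX => ?_
    refine ((hn X).eventually (lt_mem_nhds (hc' X hX))).and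
      ((hn X).eventually (gt_mem_nhds ?_))
    exact lt_of_le_of_lt ((le_abs_self _).trans ((hB X hX).trans (le_max_left _ _)))
      (lt_add_one _)
  refine ⟨c, max B 0 + 1, hc, by positivity, hev.mono fun y hy X => ?_⟩
  rcases eq_or_ne X 0 with rfl | hX
  · simp
  · have hX' : 0 < ‖X‖ := norm_pos_iff.2 hX
    have h := hy (‖X‖⁻¹ • X) (by simp [norm_smul, hX'.ne'])
    rw [map_smul_eq_mul, norm_inv, norm_norm, inv_mul_eq_div, lt_div_iff₀ hX',
      div_lt_iff₀ hX'] at h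
    exact ⟨h.1.le, h.2.le⟩

/-- The situation at a boundary point `x₀` in a holomorphic chart: near `x₀` the open set is `D`,
its defining function is `u`, the metric is given by the norms `n y`, and `-log(-u)` has complex
Hessian at least `K` times the metric. -/
structure OkaAt (u : E → ℝ) (D : Set E) (n : E → Seminorm ℝ E) (K : ℝ) (x₀ : E) : Prop where
  contDiffAt : ContDiffAt ℝ 2 u x₀
  mem_closure : x₀ ∈ closure D
  eq_zero : u x₀ = 0
  K_pos : 0 < K
  n_cont : ∀ X, ContinuousAt (fun z : E × E => n z.1 z.2) (x₀, X)
  n_pos : ∀ X, X ≠ 0 → 0 < n x₀ X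
  neg : ∀ᶠ y in 𝓝[D] x₀, u y < 0
  oka : ∀ᶠ y in 𝓝[D] x₀, ∀ X, K * n y X ^ 2 ≤
    (ddbar u y X X).re / (-u y) + ‖delForm (fderiv ℝ u y) X‖ ^ 2 / u y ^ 2

namespace OkaAt

variable {u : E → ℝ} {D : Set E} {n : E → Seminorm ℝ E} {K : ℝ} {x₀ : E}

theorem oka_tangential (h : OkaAt u D n K x₀) : ∀ᶠ y in 𝓝[D] x₀, ∀ T,
    delForm (fderiv ℝ u y) T = 0 → K * (-u y) * n y T ^ 2 ≤ (ddbar u y T T).re := by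
  filter_upwards [h.neg, h.oka] with y hy hy' T hT
  have h1 := hy' T
  rw [hT, norm_zero, zero_pow two_ne_zero, zero_div, add_zero, le_div_iff₀ (by linarith)] at h1
  linarith

/-- The boundary is pseudoconvex: tangential vectors at boundary points are limits of tangential
vectors at interior points, where the Levi form is positive. -/
theorem levi_nonneg (h : OkaAt u D n K x₀) {L : E} (hL : delForm (fderiv ℝ u x₀) L ≠ 0) {T : E}
    (hT : delForm (fderiv ℝ u x₀) T = 0) : 0 ≤ (ddbar u x₀ T T).re := by
  have : (𝓝[D] x₀).NeBot := mem_closure_iff_nhdsWithin_neBot.1 h.mem_closure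
  have hc : ∀ X, ContinuousAt (fun y => delForm (fderiv ℝ u y) X) x₀ := fun X =>
    ContinuousAt.comp (f := fun y : E => (y, X)) (continuousAt_delForm h.contDiffAt X)
      (by fun_prop)
  let V : E → E := fun y => T - (delForm (fderiv ℝ u y) T / delForm (fderiv ℝ u y) L) • L
  have hV : ContinuousAt V x₀ :=
    continuousAt_const.sub (((hc T).div (hc L) hL).smul continuousAt_const)
  have hV0 : V x₀ = T := by simp [V, hT]
  have hlim : Tendsto (fun y => (ddbar u y (V y) (V y)).re) (𝓝 x₀) (𝓝 (ddbar u x₀ T T).re) := by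
    have h1 := continuousAt_ddbar_self_re h.contDiffAt (V x₀)
    have h2 := ContinuousAt.comp (x := x₀) (g := fun z : E × E => (ddbar u z.1 z.2 z.2).re)
      (f := fun y : E => (y, V y)) h1 (continuousAt_id.prodMk hV)
    simpa only [ContinuousAt, Function.comp_def, hV0] using h2
  refine ge_of_tendsto (x := 𝓝[D] x₀) (hlim.mono_left nhdsWithin_le_nhds) ?_
  have hL' : ∀ᶠ y in 𝓝[D] x₀, delForm (fderiv ℝ u y) L ≠ 0 :=
    nhdsWithin_le_nhds ((hc L).eventually_ne hL)
  filter_upwards [h.oka_tangential, hL', h.neg] with y hy hLy hneg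
  have hVy : delForm (fderiv ℝ u y) (V y) = 0 := by
    simp only [V, sub_eq_add_neg, ← neg_smul]
    rw [delForm_add, delForm_smul]
    field_simp
    ring
  refine le_trans ?_ (hy (V y) hVy)
  have : 0 ≤ -u y := by linarith
  have := h.K_pos.le
  positivity

/-- The mixed terms of the Levi form at tangential vectors are controlled by their bound `S` in the
null directions, up to a multiple of the Levi form itself. -/
theorem mixed_bound [FiniteDimensional ℂ E] (h : OkaAt u D n K x₀) {L : E}
    (hL : delForm (fderiv ℝ u x₀) L ≠ 0)
    {S S' : ℝ} (hSS' : S < S')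
    (hS : ∀ T, T ≠ 0 → delForm (fderiv ℝ u x₀) T = 0 → (ddbar u x₀ T T).re = 0 →
      ‖ddbar u x₀ T L‖ ≤ S * n x₀ T) :
    ∃ C : ℝ, 0 ≤ C ∧ ∀ᶠ y in 𝓝[D] x₀, ∀ T, delForm (fderiv ℝ u y) T = 0 →
      ‖ddbar u y T L‖ ^ 2 ≤ S' ^ 2 * n y T ^ 2 + C * (ddbar u y T T).re := by
  have : ProperSpace E := FiniteDimensional.proper ℂ E
  have hnonneg : ∀ᶠ y in 𝓝[D] x₀, ∀ T, delForm (fderiv ℝ u y) T = 0 →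
      0 ≤ (ddbar u y T T).re := by
    filter_upwards [h.oka_tangential, h.neg] with y hy hneg T hT
    refine le_trans ?_ (hy T hT)
    have : 0 ≤ -u y := by linarith
    have := h.K_pos.le
    positivity
  have hcb : ∀ T, ContinuousAt (fun z : E × E => ‖ddbar u z.1 z.2 L‖ ^ 2) (x₀, T) := fun T =>
    (continuousAt_ddbar_left h.contDiffAt T L).norm.pow 2
  have hcn : ∀ T, ContinuousAt (fun z : E × E => S' ^ 2 * n z.1 z.2 ^ 2) (x₀, T) := fun T =>
    continuousAt_const.mul ((h.n_cont T).pow 2)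
  have key : ∃ C : ℝ, 0 ≤ C ∧ ∀ᶠ y in 𝓝[D] x₀, ∀ T ∈ Metric.sphere (0 : E) 1,
      delForm (fderiv ℝ u y) T = 0 →
      ‖ddbar u y T L‖ ^ 2 ≤ S' ^ 2 * n y T ^ 2 + C * (ddbar u y T T).re := by
    refine (isCompact_sphere (0 : E) 1).induction_on
      (p := fun s => ∃ C : ℝ, 0 ≤ C ∧ ∀ᶠ y in 𝓝[D] x₀, ∀ T ∈ s, delForm (fderiv ℝ u y) T = 0 →
        ‖ddbar u y T L‖ ^ 2 ≤ S' ^ 2 * n y T ^ 2 + C * (ddbar u y T T).re) ?_ ?_ ?_ ?_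
    · exact ⟨0, le_rfl, Eventually.of_forall fun y T hT => by simp at hT⟩
    · rintro s t hst ⟨C, hC, hev⟩
      exact ⟨C, hC, hev.mono fun y hy T hT => hy T (hst hT)⟩
    · rintro s t ⟨C, hC, hev⟩ ⟨C', hC', hev'⟩
      refine ⟨max C C', le_max_of_le_left hC, ?_⟩
      filter_upwards [hev, hev', hnonneg] with y hy hy' hq T hT hT0
      have hqT := hq T hT0
      rcases hT with hT | hT
      · refine (hy T hT hT0).trans ?_
        gcongr
        exact le_max_left _ _
      · refine (hy' T hT hT0).trans ?_
        gcongr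
        exact le_max_right _ _
    · intro T hT
      have hT0 : T ≠ 0 := ne_zero_of_mem_unit_sphere ⟨T, hT⟩
      suffices hs : ∃ C : ℝ, 0 ≤ C ∧ ∀ᶠ z : E × E in 𝓝 (x₀, T),
          delForm (fderiv ℝ u z.1) z.2 = 0 → 0 ≤ (ddbar u z.1 z.2 z.2).re →
          ‖ddbar u z.1 z.2 L‖ ^ 2 ≤ S' ^ 2 * n z.1 z.2 ^ 2 + C * (ddbar u z.1 z.2 z.2).re by
        obtain ⟨C, hC, hev⟩ := hs
        rw [nhds_prod_eq] at hev
        obtain ⟨pa, hpa, pb, hpb, hab⟩ := eventually_prod_iff.1 hev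
        refine ⟨{T | pb T}, nhdsWithin_le_nhds hpb, C, hC, ?_⟩
        filter_upwards [nhdsWithin_le_nhds hpa, hnonneg] with y hy hq T hT hT0
        exact hab hy hT hT0 (hq T hT0)
      by_cases hl : delForm (fderiv ℝ u x₀) T = 0
      · rcases (h.levi_nonneg hL hl).eq_or_lt with hq | hq
          -- null directions: the strict inequality at `T` persists nearby
        · refine ⟨0, le_rfl, ?_⟩
          have hlt : ‖ddbar u x₀ T L‖ ^ 2 < S' ^ 2 * n x₀ T ^ 2 := by
            have h1 := hS T hT0 hl hq.symm
            have h2 := h.n_pos T hT0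
            have h3 : ‖ddbar u x₀ T L‖ < S' * n x₀ T :=
              h1.trans_lt (mul_lt_mul_of_pos_right hSS' h2)
            rw [← mul_pow]
            gcongr
          filter_upwards [(hcb T).eventually_lt (hcn T) hlt] with z hz _ _
          linarith
          -- elsewhere the Levi form dominates
        · refine ⟨(‖ddbar u x₀ T L‖ ^ 2 + 1) / (ddbar u x₀ T T).re, by positivity, ?_⟩
          have hlt : ‖ddbar u x₀ T L‖ ^ 2 <
              (‖ddbar u x₀ T L‖ ^ 2 + 1) / (ddbar u x₀ T T).re * (ddbar u x₀ T T).re := by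
            rw [div_mul_cancel₀ _ hq.ne']
            exact lt_add_one _
          filter_upwards [(hcb T).eventually_lt
            (continuousAt_const.mul (continuousAt_ddbar_self_re h.contDiffAt T)) hlt] with z hz _ _
          have : 0 ≤ S' ^ 2 * n z.1 z.2 ^ 2 := by positivity
          exact hz.le.trans (le_add_of_nonneg_left this)
      · refine ⟨0, le_rfl, ?_⟩
        filter_upwards [(continuousAt_delForm h.contDiffAt T).eventually_ne hl] with z hz hz'
        exact absurd hz' hz
  obtain ⟨C, hC, hev⟩ := key
  have hsymm : ∀ᶠ y in 𝓝[D] x₀, ContDiffAt ℝ 2 u y :=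
    nhdsWithin_le_nhds (h.contDiffAt.eventually (by simp))
  refine ⟨C, hC, ?_⟩
  filter_upwards [hev, hsymm] with y hy hu T hT
  rcases eq_or_ne T 0 with rfl | hT0
  · simp [ddbar_eq_leviForm, leviForm]
  · have hn : 0 < ‖T‖ := norm_pos_iff.2 hT0
    have hy1 := hy ((‖T‖⁻¹ : ℂ) • T) (by simp [norm_smul, hn.ne'])
      (by rw [delForm_smul, hT, mul_zero])
    have hnT : n y ((‖T‖⁻¹ : ℂ) • T) = ‖T‖⁻¹ * n y T := by
      rw [← Complex.ofReal_inv, Complex.coe_smul, map_smul_eq_mul, norm_inv, norm_norm]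
    rw [hnT, ddbar_eq_leviForm, ddbar_eq_leviForm, leviForm_smul_left,
      leviForm_self_re_smul _ (fderiv_fderiv_symm hu), norm_mul, norm_inv, Complex.norm_real,
      norm_norm, ← ddbar_eq_leviForm, ← ddbar_eq_leviForm, mul_pow, mul_pow] at hy1
    have h2 : (0 : ℝ) < ‖T‖⁻¹ ^ 2 := by positivity
    refine le_of_mul_le_mul_left ?_ h2
    linarith

end OkaAt

/-- The estimate for a vector `X = a L + T` with `T` tangential; here `A = |a|`, `P` is the real
part of the mixed term and `b` the norm of its Levi form, `NT`, `NX` are squared norms and `qL`, `qT`,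
`qX` values of the complex Hessian. The Oka inequality for `X` is used with weight `1 - τ`; with
weight `τ`, the mixed term is absorbed by its neighbours, which costs the fraction `s` of the normal
term. -/
theorem nonneg_of_bounds {A g ρ b NT NX qL qT qX P K S2 C κ M τ s η : ℝ}
    (hg : 0 < g) (hρ : 0 < ρ) (hs : 0 < s) (hNT : 0 ≤ NT) (hτ0 : 0 ≤ τ)
    (hτ1 : τ ≤ 1) (hK : 0 < K) (hκ : 0 < κ)
    (h1 : |P| ≤ A * b) (h2 : b ^ 2 ≤ S2 * NT + C * qT) (h3 : K * ρ * NT ≤ qT)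
    (h4 : qX = A ^ 2 * qL + 2 * P + qT) (h5 : K * ρ ^ 2 * NX ≤ ρ * qX + A ^ 2 * g)
    (h6 : κ * NT ≤ NX + M * A ^ 2)
    (h7 : 0 ≤ g * (τ * (1 - s) - η) - τ * ρ * |qL| - (1 - τ) * K * ρ ^ 2 * M)
    (h8 : C * ρ ≤ (1 - κ) * (s * g)) (h9 : τ * S2 ≤ K * κ * (s * g)) :
    0 ≤ ρ * qX + (1 - η) * A ^ 2 * g := by
  have hsg : 0 < s * g := mul_pos hs hg
  have hqT : 0 ≤ qT := le_trans (by positivity) h3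
  have hP : -(A * b) ≤ P := (abs_le.1 h1).1
  -- everything is multiplied by `s g`
  have hAM : 2 * ρ * (A * b) * (s * g) ≤ s * g * A ^ 2 * (s * g) + ρ ^ 2 * b ^ 2 := by
    nlinarith [sq_nonneg (s * g * A - ρ * b)]
  have hb : ρ ^ 2 * b ^ 2 ≤ ρ ^ 2 * S2 * NT + ρ * ((1 - κ) * (s * g)) * qT := by
    have e1 := mul_le_mul_of_nonneg_left h2 (sq_nonneg ρ)
    have e2 := mul_le_mul_of_nonneg_right h8 (mul_nonneg hρ.le hqT)
    nlinarith
  have e1 : (1 - τ) * (K * ρ ^ 2 * (κ * NT - M * A ^ 2)) ≤ (1 - τ) * (ρ * qX + A ^ 2 * g) := by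
    refine mul_le_mul_of_nonneg_left (le_trans ?_ h5) (by linarith)
    exact mul_le_mul_of_nonneg_left (by linarith) (by positivity)
  have e2 : -(ρ * A ^ 2 * |qL|) ≤ ρ * A ^ 2 * qL := by
    have := mul_le_mul_of_nonneg_left (neg_abs_le qL) (show 0 ≤ ρ * A ^ 2 by positivity)
    linarith
  have e3 : -(ρ * (2 * (A * b))) ≤ ρ * (2 * P) := by
    have := mul_le_mul_of_nonneg_left hP hρ.le
    linarith
  have e4 : τ * (-(ρ * A ^ 2 * |qL|) - ρ * (2 * (A * b)) + ρ * qT + A ^ 2 * g) ≤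
      τ * (ρ * qX + A ^ 2 * g) := by
    refine mul_le_mul_of_nonneg_left ?_ hτ0
    rw [h4]
    linarith
  have e5 : 0 ≤ A ^ 2 *
      (g * (τ * (1 - s) - η) - τ * ρ * |qL| - (1 - τ) * K * ρ ^ 2 * M) :=
    mul_nonneg (sq_nonneg _) h7
  -- the tangential terms that remain
  have e6 : 0 ≤ (1 - τ) * (K * ρ ^ 2 * (κ * NT)) + τ * (ρ * qT - ρ * (2 * (A * b)) +
      s * g * A ^ 2) := by
    have f1 : ρ * (2 * (A * b)) * (s * g) ≤
        s * g * A ^ 2 * (s * g) + (ρ ^ 2 * S2 * NT + ρ * ((1 - κ) * (s * g)) * qT) := by linarith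
    have f2 : τ * (ρ ^ 2 * S2 * NT) ≤ ρ ^ 2 * NT * (K * κ * (s * g)) := by
      have := mul_le_mul_of_nonneg_left h9 (show 0 ≤ ρ ^ 2 * NT by positivity)
      linarith
    have f3 : τ * (ρ * κ * (s * g)) * (K * ρ * NT) ≤ τ * (ρ * κ * (s * g)) * qT :=
      mul_le_mul_of_nonneg_left h3 (by positivity)
    have f4 := mul_le_mul_of_nonneg_left f1 hτ0
    refine nonneg_of_mul_nonneg_left ?_ hsg
    linarith
  linarith

namespace OkaAt

variable {u : E → ℝ} {D : Set E} {n : E → Seminorm ℝ E} {K : ℝ} {x₀ : E}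

/-- The inequality `(-u) ∂∂̄u + (1 - η) ∂u ∧ ∂̄u ≥ 0` at interior points near `x₀`. The vector
`L` is fixed: it only has to be transverse to the complex tangent spaces, not orthogonal to them. -/
theorem eventually_df_inequality [FiniteDimensional ℂ E] (h : OkaAt u D n K x₀) {L : E}
    (hL : 1 / 2 ≤ ‖delForm (fderiv ℝ u x₀) L‖ ^ 2) {S : ℝ}
    (hS : ∀ T, T ≠ 0 → delForm (fderiv ℝ u x₀) T = 0 → (ddbar u x₀ T T).re = 0 →
      ‖ddbar u x₀ T L‖ ≤ S * n x₀ T)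
    {τ s η : ℝ} (hτ0 : 0 ≤ τ) (hτ1 : τ ≤ 1) (hs : 0 < s) (hη : η < τ * (1 - s))
    (hτS : τ * S ^ 2 < K * s / 2) :
    ∀ᶠ y in 𝓝[D] x₀, ∀ X, 0 ≤ (-u y) * (ddbar u y X X).re +
      (1 - η) * ‖delForm (fderiv ℝ u y) X‖ ^ 2 := by
  have hK := h.K_pos
  have hL0 : delForm (fderiv ℝ u x₀) L ≠ 0 := by
    intro h0
    rw [h0] at hL
    norm_num at hL
  -- the strict inequality leaves room to enlarge `S`
  obtain ⟨S', hSS', hS'⟩ : ∃ S', S < S' ∧ τ * S' ^ 2 < K * s / 2 := by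
    have hc : Tendsto (fun t : ℝ => τ * t ^ 2) (𝓝[>] S) (𝓝 (τ * S ^ 2)) :=
      ((continuous_const.mul (continuous_id.pow 2)).tendsto S).mono_left nhdsWithin_le_nhds
    obtain ⟨t, ht, ht'⟩ := ((hc.eventually (gt_mem_nhds hτS)).and
      (self_mem_nhdsWithin : Set.Ioi S ∈ 𝓝[>] S)).exists
    exact ⟨t, ht', ht⟩
  -- `κ < 1` takes up all the errors that tend to `0` at `x₀`; near `x₀`, `|∂u(L)|² ≥ κ / 2`
  obtain ⟨κ, hκ0, hκ1, hκ⟩ : ∃ κ, 0 < κ ∧ κ < 1 ∧ τ * S' ^ 2 ≤ K * κ * (s * (κ / 2)) := by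
    have hc : Tendsto (fun t : ℝ => K * t * (s * (t / 2))) (𝓝[<] 1)
        (𝓝 (K * 1 * (s * (1 / 2)))) := by
      have : Continuous fun t : ℝ => K * t * (s * (t / 2)) := by fun_prop
      exact (this.tendsto 1).mono_left nhdsWithin_le_nhds
    obtain ⟨t, ht, ht'⟩ := ((hc.eventually (lt_mem_nhds (show τ * S' ^ 2 < _ by linarith))).and
      (Ioo_mem_nhdsLT (show (0 : ℝ) < 1 by norm_num))).exists
    exact ⟨t, ht'.1, ht'.2, ht.le⟩
  obtain ⟨C, hC, hmix⟩ := h.mixed_bound hL0 hSS' hS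
  obtain ⟨c, B, -, hB, hnB⟩ := exists_norm_equiv h.n_cont h.n_pos
  set M := κ / (1 - κ) * (B * ‖L‖) ^ 2 with hM
  have hcL : ContinuousAt (fun y => ‖delForm (fderiv ℝ u y) L‖ ^ 2) x₀ :=
    (ContinuousAt.comp (f := fun y : E => (y, L)) (continuousAt_delForm h.contDiffAt L)
      (by fun_prop)).norm.pow 2
  have hcq : ContinuousAt (fun y => (ddbar u y L L).re) x₀ :=
    continuousAt_ddbar_re h.contDiffAt L
  have hcu : ContinuousAt u x₀ := h.contDiffAt.continuousAt
  have hg : ∀ᶠ y in 𝓝[D] x₀, κ / 2 < ‖delForm (fderiv ℝ u y) L‖ ^ 2 :=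
    nhdsWithin_le_nhds (hcL.eventually (lt_mem_nhds (by linarith)))
  have h7 : ∀ᶠ y in 𝓝[D] x₀, 0 < ‖delForm (fderiv ℝ u y) L‖ ^ 2 * (τ * (1 - s) - η) -
      τ * (-u y) * |(ddbar u y L L).re| - (1 - τ) * K * (-u y) ^ 2 * M := by
    have hcont : ContinuousAt (fun y => ‖delForm (fderiv ℝ u y) L‖ ^ 2 * (τ * (1 - s) - η) -
        τ * (-u y) * |(ddbar u y L L).re| - (1 - τ) * K * (-u y) ^ 2 * M) x₀ := by
      have := hcq.abs
      fun_prop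
    refine nhdsWithin_le_nhds (hcont.eventually (lt_mem_nhds ?_))
    simp only [h.eq_zero]
    have : 0 < ‖delForm (fderiv ℝ u x₀) L‖ ^ 2 * (τ * (1 - s) - η) :=
      mul_pos (by linarith) (by linarith)
    simpa using this
  have h8 : ∀ᶠ y in 𝓝[D] x₀, C * (-u y) < (1 - κ) * (s * (κ / 2)) := by
    have hcont : ContinuousAt (fun y => C * (-u y)) x₀ := by fun_prop
    refine nhdsWithin_le_nhds (hcont.eventually (gt_mem_nhds ?_))
    simp only [h.eq_zero, neg_zero, mul_zero]
    exact mul_pos (by linarith) (by positivity)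
  filter_upwards [hmix, nhdsWithin_le_nhds hnB, hg, h7, h8, h.oka, h.oka_tangential, h.neg,
    nhdsWithin_le_nhds (h.contDiffAt.eventually (by simp))]
    with y hmix hnB hg h7 h8 hoka htan hneg hu X
  have hsymm := fderiv_fderiv_symm hu
  have hg0 : 0 < ‖delForm (fderiv ℝ u y) L‖ ^ 2 := lt_trans (by positivity) hg
  have hl0 : delForm (fderiv ℝ u y) L ≠ 0 := by
    intro h0
    simp [h0] at hg0
  set a := delForm (fderiv ℝ u y) X / delForm (fderiv ℝ u y) L with ha
  have haL : delForm (fderiv ℝ u y) X = a * delForm (fderiv ℝ u y) L := by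
    rw [ha, div_mul_cancel₀ _ hl0]
  set T := X - a • L with hT
  have hX : X = T + a • L := by rw [hT, sub_add_cancel]
  have hTl : delForm (fderiv ℝ u y) T = 0 := by
    have h1 : delForm (fderiv ℝ u y) X = _ := congrArg (delForm (fderiv ℝ u y)) hX
    rw [delForm_add, delForm_smul, haL] at h1
    simpa using h1
  have hρ : 0 < -u y := by linarith
  have hqX : (ddbar u y X X).re = ‖a‖ ^ 2 * (ddbar u y L L).re +
      2 * (ddbar u y T (a • L)).re + (ddbar u y T T).re := by
    simp only [ddbar_eq_leviForm]
    rw [← leviForm_self_re_smul _ hsymm, hX, leviForm_self_re_add _ hsymm]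
    ring
  have hP : |(ddbar u y T (a • L)).re| ≤ ‖a‖ * ‖ddbar u y T L‖ := by
    refine (Complex.abs_re_le_norm _).trans (le_of_eq ?_)
    rw [ddbar_eq_leviForm, leviForm_conj_symm _ hsymm, leviForm_smul_left, RCLike.norm_conj,
      norm_mul, leviForm_conj_symm _ hsymm, RCLike.norm_conj, ddbar_eq_leviForm]
  have hlX : ‖delForm (fderiv ℝ u y) X‖ ^ 2 = ‖a‖ ^ 2 * ‖delForm (fderiv ℝ u y) L‖ ^ 2 := by
    rw [haL, norm_mul, mul_pow]
  have h5 : K * (-u y) ^ 2 * n y X ^ 2 ≤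
      (-u y) * (ddbar u y X X).re + ‖a‖ ^ 2 * ‖delForm (fderiv ℝ u y) L‖ ^ 2 := by
    have h1 := mul_le_mul_of_nonneg_left (hoka X) (sq_nonneg (-u y))
    rw [hlX] at h1
    have h2 : (-u y) ^ 2 * ((ddbar u y X X).re / (-u y) +
        ‖a‖ ^ 2 * ‖delForm (fderiv ℝ u y) L‖ ^ 2 / u y ^ 2) =
        (-u y) * (ddbar u y X X).re + ‖a‖ ^ 2 * ‖delForm (fderiv ℝ u y) L‖ ^ 2 := by
      have : u y ≠ 0 := hneg.ne
      field_simp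
    linarith
  have h6 : κ * n y T ^ 2 ≤ n y X ^ 2 + M * ‖a‖ ^ 2 := by
    have h1 : n y T ≤ n y X + B * ‖L‖ * ‖a‖ := by
      rw [hT]
      refine (map_sub_le_add (n y) _ _).trans ?_
      gcongr
      refine (hnB _).2.trans (le_of_eq ?_)
      rw [norm_smul]
      ring
    have h2 : n y T ^ 2 ≤ (n y X + B * ‖L‖ * ‖a‖) ^ 2 := by
      have := apply_nonneg (n y) T
      gcongr
    have h3 : κ * (n y X + B * ‖L‖ * ‖a‖) ^ 2 ≤ n y X ^ 2 + M * ‖a‖ ^ 2 := by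
      have hk : 0 < 1 - κ := by linarith
      rw [← sub_nonneg]
      have : n y X ^ 2 + M * ‖a‖ ^ 2 - κ * (n y X + B * ‖L‖ * ‖a‖) ^ 2 =
          ((1 - κ) * n y X - κ * (B * ‖L‖ * ‖a‖)) ^ 2 / (1 - κ) := by
        rw [hM]
        field_simp
        ring
      rw [this]
      positivity
    exact (mul_le_mul_of_nonneg_left h2 hκ0.le).trans h3
  have hfin := nonneg_of_bounds hg0 hρ hs (sq_nonneg (n y T)) hτ0 hτ1 hK hκ0 hP (hmix T hTl)
    (htan T hTl) hqX h5 h6 h7.le (h8.le.trans (by gcongr)) (hκ.trans (by gcongr))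
  rw [hlX]
  linarith

end OkaAt

end Local

/-! ### The metric and the differential in a preferred chart -/

section Charts

variable {E : Type*} [NormedAddCommGroup E] [NormedSpace ℂ E]
variable {M : Type*} [TopologicalSpace M] [ChartedSpace E M]

section ChartNorm

variable [RiemannianBundle (fun x : M => TangentSpace 𝓘(ℝ, E) x)]

/-- The norm `|X|_ω` in the chart `e`. -/
def chartNorm (e : OpenPartialHomeomorph M E) (y : E) : Seminorm ℝ E :=
  Seminorm.of
    (fun X => ‖(mfderiv 𝓘(ℝ, E) 𝓘(ℝ, E) e.symm y X : TangentSpace 𝓘(ℝ, E) (e.symm y))‖ / √2)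
    (fun X Y => by
      have h : (mfderiv 𝓘(ℝ, E) 𝓘(ℝ, E) e.symm y (X + Y) : TangentSpace 𝓘(ℝ, E) (e.symm y)) =
        mfderiv 𝓘(ℝ, E) 𝓘(ℝ, E) e.symm y X + mfderiv 𝓘(ℝ, E) 𝓘(ℝ, E) e.symm y Y := map_add _ X Y
      rw [h, ← add_div]
      gcongr
      exact norm_add_le _ _)
    (fun a X => by
      have h : (mfderiv 𝓘(ℝ, E) 𝓘(ℝ, E) e.symm y (a • X) : TangentSpace 𝓘(ℝ, E) (e.symm y)) =
        a • mfderiv 𝓘(ℝ, E) 𝓘(ℝ, E) e.symm y X := map_smul _ a X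
      rw [h, norm_smul, mul_div_assoc])

theorem chartNorm_apply (e : OpenPartialHomeomorph M E) (y X : E) : chartNorm e y X =
    ‖(mfderiv 𝓘(ℝ, E) 𝓘(ℝ, E) e.symm y X : TangentSpace 𝓘(ℝ, E) (e.symm y))‖ / √2 := rfl

theorem normSqω_mfderiv_symm (e : OpenPartialHomeomorph M E) (y X : E) :
    normSqω (mfderiv 𝓘(ℝ, E) 𝓘(ℝ, E) e.symm y X) = chartNorm e y X ^ 2 := by
  rw [normSqω_eq, chartNorm_apply, div_pow, Real.sq_sqrt (by norm_num)]

theorem norm_tangent_congr {z z' : M} (h : z' = z) (w : TangentSpace 𝓘(ℝ, E) z')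
    (v : TangentSpace 𝓘(ℝ, E) z) (hvw : (w : E) = (v : E)) : ‖w‖ = ‖v‖ := by
  subst h
  exact congrArg _ hvw

end ChartNorm

variable [IsManifold 𝓘(ℂ, E) ω M]

theorem mfderiv_chartAt_self (p : M) (v : TangentSpace 𝓘(ℝ, E) p) :
    mfderiv 𝓘(ℝ, E) 𝓘(ℝ, E) (chartAt E p) p v = v := by
  have h := mfderiv_extChartAt_self (I := 𝓘(ℝ, E)) (x := p)
  have h2 : (extChartAt 𝓘(ℝ, E) p : M → E) = chartAt E p := by
    ext z
    simp
  rw [h2] at h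
  rw [h]
  rfl

theorem mdifferentiable_chart_real (p : M) :
    (chartAt E p).MDifferentiable 𝓘(ℝ, E) 𝓘(ℝ, E) := mdifferentiable_chart p

theorem contDiffAt_comp_chart_symm {r : M → ℝ} {U : Set M} (hU : IsOpen U)
    (hr : ContMDiffOn 𝓘(ℝ, E) 𝓘(ℝ, ℝ) 2 r U) (p : M) {y : E} (hy : y ∈ (chartAt E p).target)
    (hyU : (chartAt E p).symm y ∈ U) :
    ContDiffAt ℝ 2 (fun x => r ((chartAt E p).symm x)) y := by
  rw [← contMDiffAt_iff_contDiffAt]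
  have h1 : ContMDiffAt 𝓘(ℝ, E) 𝓘(ℝ, E) 2 (chartAt E p).symm y :=
    contMDiffAt_symm_of_mem_maximalAtlas (IsManifold.chart_mem_maximalAtlas p) hy
  exact (hr.contMDiffAt (hU.mem_nhds hyU)).comp y h1

theorem dReal_eq_fderiv {r : M → ℝ} {p z : M} (hz : z ∈ (chartAt E p).source)
    (hr : DifferentiableAt ℝ (fun x => r ((chartAt E p).symm x)) (chartAt E p z))
    (v : TangentSpace 𝓘(ℝ, E) z) :
    dReal r z v = fderiv ℝ (fun x => r ((chartAt E p).symm x)) (chartAt E p z)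
      (mfderiv 𝓘(ℝ, E) 𝓘(ℝ, E) (chartAt E p) z v) := by
  have h1 : r =ᶠ[𝓝 z] (fun x => r ((chartAt E p).symm x)) ∘ chartAt E p := by
    filter_upwards [(chartAt E p).open_source.mem_nhds hz] with x hx
    simp [(chartAt E p).left_inv hx]
  have h2 := mfderiv_comp z hr.mdifferentiableAt
    ((mdifferentiable_chart_real p).mdifferentiableAt hz)
  rw [dReal, h1.mfderiv_eq, h2, mfderiv_eq_fderiv]
  rfl

theorem delForm_comp_chart_self {r : M → ℝ} {p : M}
    (hr : DifferentiableAt ℝ (fun x => r ((chartAt E p).symm x)) (chartAt E p p))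
    (X : TangentSpace 𝓘(ℝ, E) p) :
    delForm (fderiv ℝ (fun x => r ((chartAt E p).symm x)) (chartAt E p p)) X = del r p X := by
  have h : ∀ v : TangentSpace 𝓘(ℝ, E) p, dReal r p v =
      fderiv ℝ (fun x => r ((chartAt E p).symm x)) (chartAt E p p) v := by
    intro v
    rw [dReal_eq_fderiv (mem_chart_source E p) hr, mfderiv_chartAt_self]
  rw [del, h, h]
  rfl

variable [RiemannianBundle (fun x : M => TangentSpace 𝓘(ℝ, E) x)]

theorem chartNorm_mfderiv {p z : M} (hz : z ∈ (chartAt E p).source)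
    (v : TangentSpace 𝓘(ℝ, E) z) :
    chartNorm (chartAt E p) (chartAt E p z) (mfderiv 𝓘(ℝ, E) 𝓘(ℝ, E) (chartAt E p) z v) =
      ‖v‖ / √2 := by
  change _ / √2 = _
  congr 1
  refine norm_tangent_congr ((chartAt E p).left_inv hz) _ _ ?_
  have h := (mdifferentiable_chart_real p).symm_comp_deriv hz
  exact congrArg (fun A : E →L[ℝ] E => A v) h

theorem chartNorm_pos {p : M} {y : E} (hy : y ∈ (chartAt E p).target) {X : E} (hX : X ≠ 0) :
    0 < chartNorm (chartAt E p) y X := by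
  rw [chartNorm_apply]
  refine div_pos (norm_pos_iff.2 fun h0 => hX ?_) (by positivity)
  have h := (mdifferentiable_chart_real p).comp_symm_deriv hy
  have h1 := congrArg (fun A : E →L[ℝ] E => A X) h
  have h2 : mfderiv 𝓘(ℝ, E) 𝓘(ℝ, E) (chartAt E p) ((chartAt E p).symm y)
    (mfderiv 𝓘(ℝ, E) 𝓘(ℝ, E) (chartAt E p).symm y X) = X := h1
  rw [← h2, h0]
  exact map_zero _

theorem isContinuousRiemannianBundle_tangent [h : IsContMDiffRiemannianBundle 𝓘(ℝ, E) ∞ E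
    (fun x : M => TangentSpace 𝓘(ℝ, E) x)] :
    IsContinuousRiemannianBundle E (fun x : M => TangentSpace 𝓘(ℝ, E) x) := by
  obtain ⟨g, hg, hg'⟩ := h.exists_contMDiff
  exact ⟨g, hg.continuous, hg'⟩

theorem continuousAt_chartNorm [IsContMDiffRiemannianBundle 𝓘(ℝ, E) ∞ E
    (fun x : M => TangentSpace 𝓘(ℝ, E) x)] {p : M} {y : E} (hy : y ∈ (chartAt E p).target) (X : E) :
    ContinuousAt (fun z : E × E => chartNorm (chartAt E p) z.1 z.2) (y, X) := by
  have := isContinuousRiemannianBundle_tangent (E := E) (M := M)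
  set e := chartAt E p with he
  have hopen : IsOpen (Prod.fst ⁻¹' e.target : Set (E × E)) :=
    e.open_target.preimage continuous_fst
  have h1 : ContMDiffOn 𝓘(ℝ, E) 𝓘(ℝ, E) 1 e.symm e.target :=
    contMDiffOn_symm_of_mem_maximalAtlas (IsManifold.chart_mem_maximalAtlas p)
  have h2 := h1.continuousOn_tangentMapWithin le_rfl e.open_target.uniqueMDiffOn
  have h3 : Continuous fun z : E × E => (⟨z.1, z.2⟩ : TangentBundle 𝓘(ℝ, E) E) :=
    (tangentBundleModelSpaceHomeomorph 𝓘(ℝ, E)).symm.continuous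
  have h4 : ContinuousOn (fun z : E × E =>
      (⟨e.symm z.1, mfderiv 𝓘(ℝ, E) 𝓘(ℝ, E) e.symm z.1 z.2⟩ : TangentBundle 𝓘(ℝ, E) M))
      (Prod.fst ⁻¹' e.target) := by
    refine (h2.comp h3.continuousOn (fun z hz => hz)).congr fun z hz => ?_
    simp only [tangentMapWithin, Function.comp_apply]
    rw [mfderivWithin_of_isOpen e.open_target hz]
  have h5 := ContinuousOn.inner_bundle (F := E) (E := fun x : M => TangentSpace 𝓘(ℝ, E) x) h4 h4
  have h6 := h5.continuousAt (hopen.mem_nhds (show (y, X) ∈ Prod.fst ⁻¹' e.target from hy))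
  refine ContinuousAt.div_const ?_ _
  simp only [real_inner_self_eq_norm_sq] at h6
  simpa [Real.sqrt_sq] using h6.sqrt

end Charts

/-! ### The gradient of a normalized defining function -/

section Normalized

variable {E : Type*} [NormedAddCommGroup E] [NormedSpace ℂ E]
variable {M : Type*} [TopologicalSpace M] [ChartedSpace E M]
variable [RiemannianBundle (fun x : M => TangentSpace 𝓘(ℝ, E) x)]

/-- A bound for the differential of `r` along a path bounds the oscillation of `r` by the length. -/
theorem enorm_sub_le_pathELength {r : M → ℝ} {V : Set M} {c : ℝ}
    (hr : ∀ z ∈ V, ContMDiffAt 𝓘(ℝ, E) 𝓘(ℝ, ℝ) 1 r z)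
    (hc : ∀ z ∈ V, ∀ v : TangentSpace 𝓘(ℝ, E) z, |dReal r z v| ≤ c * ‖v‖)
    {γ : ℝ → M} (hγ : ContMDiff 𝓘(ℝ, ℝ) 𝓘(ℝ, E) 1 γ) (hγV : ∀ t ∈ Set.Icc (0 : ℝ) 1, γ t ∈ V) :
    ‖r (γ 1) - r (γ 0)‖ₑ ≤ ENNReal.ofReal c * Manifold.pathELength 𝓘(ℝ, E) γ 0 1 := by
  have hf : ContDiffOn ℝ 1 (r ∘ γ) (Set.Icc 0 1) := by
    intro t ht
    have : ContMDiffAt 𝓘(ℝ, ℝ) 𝓘(ℝ, ℝ) 1 (r ∘ γ) t := (hr _ (hγV t ht)).comp t (hγ t)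
    exact (contMDiffAt_iff_contDiffAt.1 this).contDiffWithinAt
  refine (enorm_sub_le_lintegral_deriv_of_contDiffOn_Icc hf zero_le_one).trans ?_
  rw [Manifold.pathELength_eq_lintegral_mfderiv_Icc,
    ← lintegral_const_mul' _ _ ENNReal.ofReal_ne_top]
  refine setLIntegral_mono' measurableSet_Icc fun t ht => ?_
  have h1 : mfderiv 𝓘(ℝ, ℝ) 𝓘(ℝ, ℝ) (r ∘ γ) t =
      (mfderiv 𝓘(ℝ, E) 𝓘(ℝ, ℝ) r (γ t)).comp (mfderiv 𝓘(ℝ, ℝ) 𝓘(ℝ, E) γ t) :=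
    mfderiv_comp t ((hr _ (hγV t ht)).mdifferentiableAt one_ne_zero)
      ((hγ t).mdifferentiableAt one_ne_zero)
  have h2 : deriv (r ∘ γ) t = dReal r (γ t) (mfderiv 𝓘(ℝ, ℝ) 𝓘(ℝ, E) γ t (1 : ℝ)) := by
    rw [← fderiv_apply_one_eq_deriv, ← mfderiv_eq_fderiv, h1]
    rfl
  rw [h2, Real.enorm_eq_ofReal_abs]
  have h3 := hc _ (hγV t ht) (mfderiv 𝓘(ℝ, ℝ) 𝓘(ℝ, E) γ t (1 : ℝ))
  refine (ENNReal.ofReal_le_ofReal h3).trans ?_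
  rw [ENNReal.ofReal_mul' (norm_nonneg _), ofReal_norm]
  exact le_rfl

theorem IsDefiningFunction.eq_zero {Ω : Set M} {r : M → ℝ} (hr : IsDefiningFunction E Ω r) {q : M}
    (hq : q ∈ frontier Ω) : r q = 0 := by
  obtain ⟨C₁, C₂, hC₁, hC₂, hcomp⟩ := hr.comparable
  have h1 := (hcomp.self_of_nhdsSet q hq).2
  have h2 : bdist E Ω q = 0 := by
    refine le_antisymm ((iInf₂_le q hq).trans ?_) bot_le
    rw [Manifold.riemannianEDist_self]
  rw [h2, mul_zero, nonpos_iff_eq_zero, ENNReal.ofReal_eq_zero] at h1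
  exact abs_eq_zero.1 (le_antisymm h1 (abs_nonneg _))

variable [IsManifold 𝓘(ℂ, E) ω M]
variable [IsContMDiffRiemannianBundle 𝓘(ℝ, E) ∞ E (fun x : M => TangentSpace 𝓘(ℝ, E) x)]
variable [FiniteDimensional ℂ E]

/-- The norm of the differential is upper semicontinuous. -/
theorem eventually_dReal_le {r : M → ℝ} {U : Set M} (hU : IsOpen U)
    (hr : ContMDiffOn 𝓘(ℝ, E) 𝓘(ℝ, ℝ) 2 r U) {p : M} (hp : p ∈ U) {c : ℝ}
    (hc : ‖grad (E := E) r p‖ < c) :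
    ∀ᶠ z in 𝓝 p, ∀ v : TangentSpace 𝓘(ℝ, E) z, |dReal r z v| ≤ c * ‖v‖ := by
  have : ProperSpace E := FiniteDimensional.proper ℂ E
  set e := chartAt E p with he
  set u : E → ℝ := fun x => r (e.symm x) with hu
  set x₀ := e p with hx₀
  have hps : p ∈ e.source := mem_chart_source E p
  have hx₀t : x₀ ∈ e.target := e.map_source hps
  have hux : ContDiffAt ℝ 2 u x₀ :=
    contDiffAt_comp_chart_symm hU hr p hx₀t (by rwa [e.left_inv hps])
  have hev : ∀ᶠ y in 𝓝 x₀, ∀ X ∈ Metric.sphere (0 : E) 1,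
      |fderiv ℝ u y X| < c * (chartNorm e y X * √2) := by
    refine (isCompact_sphere (0 : E) 1).eventually_forall_of_forall_eventually fun X hX => ?_
    have hX0 : X ≠ 0 := ne_zero_of_mem_unit_sphere ⟨X, hX⟩
    have h1 : ContinuousAt (fun z : E × E => fderiv ℝ u z.1) (x₀, X) :=
      ContinuousAt.comp (f := fun z : E × E => z.1)
        (differentiableAt_fderiv hux).continuousAt continuousAt_fst
    have h2 : ContinuousAt (fun z : E × E => |fderiv ℝ u z.1 z.2|) (x₀, X) :=
      (h1.clm_apply continuousAt_snd).abs
    have h3 : ContinuousAt (fun z : E × E => c * (chartNorm e z.1 z.2 * √2)) (x₀, X) :=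
      continuousAt_const.mul ((continuousAt_chartNorm hx₀t X).mul continuousAt_const)
    refine h2.eventually_lt h3 ?_
    let v : TangentSpace 𝓘(ℝ, E) p := X
    have h4 : fderiv ℝ u x₀ X = dReal r p v := by
      rw [dReal_eq_fderiv hps (hux.differentiableAt (by norm_num)), mfderiv_chartAt_self]
    have h5 : chartNorm e x₀ X * √2 = ‖v‖ := by
      have h6 := chartNorm_mfderiv hps v
      rw [mfderiv_chartAt_self] at h6
      have h7 : chartNorm e x₀ X = ‖v‖ / √2 := h6
      rw [h7, div_mul_cancel₀ _ (by positivity)]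
    have hv : 0 < ‖v‖ := by
      rw [← h5]
      exact mul_pos (chartNorm_pos hx₀t hX0) (by positivity)
    simp only
    rw [h4, h5, ← inner_grad]
    exact (abs_real_inner_le_norm _ _).trans_lt (mul_lt_mul_of_pos_right hc hv)
  have hcont : Tendsto e (𝓝 p) (𝓝 x₀) := e.continuousAt hps
  filter_upwards [hcont.eventually hev, e.open_source.mem_nhds hps,
    hcont.eventually (eventually_differentiableAt hux)] with z hz hzs hd v
  rw [dReal_eq_fderiv hzs hd]
  have hn : c * ‖v‖ = c * (chartNorm e (e z) (mfderiv 𝓘(ℝ, E) 𝓘(ℝ, E) e z v) * √2) := by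
    have h6 := chartNorm_mfderiv hzs v
    have h7 : chartNorm e (e z) (mfderiv 𝓘(ℝ, E) 𝓘(ℝ, E) e z v) = ‖v‖ / √2 := h6
    rw [h7, div_mul_cancel₀ _ (by positivity)]
  rw [hn]
  generalize (mfderiv 𝓘(ℝ, E) 𝓘(ℝ, E) e z v : TangentSpace 𝓘(ℝ, E) (e z)) = X
  change E at X
  change |fderiv ℝ u (e z) X| ≤ _
  rcases eq_or_ne X 0 with rfl | hX
  · simp
  · have hX' : 0 < ‖X‖ := norm_pos_iff.2 hX
    have h := hz (‖X‖⁻¹ • X) (by simp [norm_smul, hX'.ne'])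
    rw [map_smul, map_smul_eq_mul, norm_inv, norm_norm, smul_eq_mul, abs_mul, abs_inv,
      abs_of_pos hX'] at h
    have h8 : ‖X‖⁻¹ * |fderiv ℝ u (e z) X| < ‖X‖⁻¹ * (c * (chartNorm e (e z) X * √2)) := by
      linarith
    exact (lt_of_mul_lt_mul_left h8 (by positivity)).le

/-- The gradient of a normalized defining function has length at least one on the boundary: were it
shorter at `p`, a nearly shortest path from a point close to `p` to the boundary would show that
`|r|` is smaller than the distance by a fixed factor. -/
theorem one_le_norm_grad [T2Space M] {Ω : Set M} (hopen : IsOpen Ω) {r : M → ℝ}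
    (hr : IsDefiningFunction E Ω r) (hnorm : IsNormalized E Ω r) {p : M} (hp : p ∈ frontier Ω) :
    1 ≤ ‖grad (E := E) r p‖ := by
  by_contra! hlt
  have : ProperSpace E := FiniteDimensional.proper ℂ E
  have : LocallyCompactSpace M := ChartedSpace.locallyCompactSpace E M
  have := isContinuousRiemannianBundle_tangent (E := E) (M := M)
  obtain ⟨U, hU, hUf, hrU⟩ := hr.smooth
  obtain ⟨c, hc, hc1⟩ := exists_between (max_lt hlt (show (1 / 2 : ℝ) < 1 by norm_num))
  have hcg : ‖grad (E := E) r p‖ < c := (le_max_left _ _).trans_lt hc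
  have hc2 : 1 / 2 < c := (le_max_right _ _).trans_lt hc
  have hV : {z | z ∈ U ∧ ∀ v : TangentSpace 𝓘(ℝ, E) z, |dReal r z v| ≤ c * ‖v‖} ∈ 𝓝 p :=
    Filter.Eventually.and (hU.mem_nhds (hUf hp)) (eventually_dReal_le hU hrU (hUf hp) hcg)
  obtain ⟨d, hd, hdV⟩ := setOfPred_riemannianEDist_lt_subset_nhds' 𝓘(ℝ, E) hV
  obtain ⟨d', hd', hdd'⟩ : ∃ d' : ℝ≥0∞, 0 < d' ∧ d' + 2 * d' ≤ d := by
    refine ⟨d / 3, ENNReal.div_pos hd.ne' (by norm_num), ?_⟩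
    have : d / 3 + 2 * (d / 3) = 3 * (d / 3) := by ring
    rw [this]
    exact ENNReal.mul_div_le
  -- a point of `Ω` near `p`
  have hne : (𝓝[Ω] p).NeBot := mem_closure_iff_nhdsWithin_neBot.1 (frontier_subset_closure hp)
  have hdisj : Ω ⊆ (frontier Ω)ᶜ := fun z hz hz' => (hopen.frontier_eq ▸ hz').2 hz
  have hle : 𝓝[Ω] p ≤ 𝓝ˢ (frontier Ω) ⊓ 𝓟 (frontier Ω)ᶜ :=
    inf_le_inf (nhds_le_nhdsSet hp) (principal_mono.2 hdisj)
  obtain ⟨C₁, C₂, hC₁, hC₂, hcomp⟩ := hr.comparable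
  have hratio : ∀ᶠ z in 𝓝[Ω] p, (1 + c) / 2 < |r z| / (bdist E Ω z).toReal :=
    (hnorm.mono_left hle).eventually (lt_mem_nhds (by linarith))
  have hcomp' : ∀ᶠ z in 𝓝[Ω] p, ENNReal.ofReal |r z| ≤ ENNReal.ofReal C₂ * bdist E Ω z :=
    (hcomp.filter_mono ((nhds_le_nhdsSet hp).trans' nhdsWithin_le_nhds)).mono fun z hz => hz.2
  obtain ⟨z, hz, hzΩ, hzc, hzd⟩ := (hratio.and
    ((eventually_mem_nhdsWithin : ∀ᶠ z in 𝓝[Ω] p, z ∈ Ω).and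
    (hcomp'.and (nhdsWithin_le_nhds (eventually_riemannianEDist_lt 𝓘(ℝ, E) p hd'))))).exists
  have hδd : bdist E Ω z < d' := by
    refine lt_of_le_of_lt (iInf₂_le p hp) ?_
    rwa [Manifold.riemannianEDist_comm]
  have hδtop : bdist E Ω z ≠ ⊤ := hδd.ne_top
  have hrz : 0 < |r z| := abs_pos.2 (hr.neg z hzΩ).ne
  have hδ0 : bdist E Ω z ≠ 0 := by
    intro h0
    rw [h0, mul_zero, nonpos_iff_eq_zero, ENNReal.ofReal_eq_zero] at hzc
    linarith
  set δ := (bdist E Ω z).toReal with hδ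
  have hδpos : 0 < δ := ENNReal.toReal_pos hδ0 hδtop
  have hδeq : bdist E Ω z = ENNReal.ofReal δ := (ENNReal.ofReal_toReal hδtop).symm
  -- a path to the boundary of length less than `t δ`, where `t > 1` and `t c = (1 + c) / 2 < 1`
  set t := (1 + c) / (2 * c) with ht
  have ht1 : 1 < t := by
    rw [ht, lt_div_iff₀ (by linarith)]
    linarith
  have ht2 : t < 2 := by
    rw [ht, div_lt_iff₀ (by linarith)]
    linarith
  have hlt' : bdist E Ω z < ENNReal.ofReal (t * δ) := by
    rw [hδeq, ENNReal.ofReal_lt_ofReal_iff (by positivity)]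
    nlinarith
  obtain ⟨q, hq⟩ := iInf_lt_iff.1 hlt'
  obtain ⟨hqf, hq⟩ := iInf_lt_iff.1 hq
  obtain ⟨γ, hγ0, hγ1, hγ, hlen, -⟩ :=
    Manifold.exists_lt_locally_constant_of_riemannianEDist_lt hq (zero_lt_one' ℝ)
  have hlen' : ENNReal.ofReal (t * δ) ≤ 2 * d' := by
    rw [ENNReal.ofReal_mul (by linarith), ← hδeq]
    refine mul_le_mul' ?_ hδd.le
    rw [← ENNReal.ofReal_ofNat]
    exact ENNReal.ofReal_le_ofReal ht2.le
  have hγV : ∀ s ∈ Set.Icc (0 : ℝ) 1,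
      γ s ∈ {z | z ∈ U ∧ ∀ v : TangentSpace 𝓘(ℝ, E) z, |dReal r z v| ≤ c * ‖v‖} := by
    intro s hs
    refine hdV ?_
    change Manifold.riemannianEDist 𝓘(ℝ, E) p (γ s) < d
    have h1 : Manifold.riemannianEDist 𝓘(ℝ, E) z (γ s) ≤ Manifold.pathELength 𝓘(ℝ, E) γ 0 1 :=
      (Manifold.riemannianEDist_le_pathELength hγ.contMDiffOn hγ0 rfl hs.1).trans
        (Manifold.pathELength_mono le_rfl hs.2)
    refine (Manifold.riemannianEDist_triangle (y := z)).trans_lt (lt_of_lt_of_le ?_ hdd')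
    exact ENNReal.add_lt_add hzd (h1.trans_lt (hlen.trans_le hlen'))
  have hfin := enorm_sub_le_pathELength
    (fun z hz => ((hrU.contMDiffAt (hU.mem_nhds hz.1)).of_le (by norm_num)))
    (fun z hz => hz.2) hγ hγV
  rw [hγ0, hγ1, hr.eq_zero hqf, zero_sub, enorm_neg, Real.enorm_eq_ofReal_abs] at hfin
  have hfin2 := hfin.trans (mul_le_mul_right hlen.le _)
  rw [← ENNReal.ofReal_mul (by linarith), ENNReal.ofReal_le_ofReal_iff (by positivity)] at hfin2
  rw [lt_div_iff₀ hδpos] at hz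
  have : c * (t * δ) = (1 + c) / 2 * δ := by
    rw [ht]
    field_simp
  linarith

end Normalized

/-! ### Holomorphic changes of charts -/

section ChartImage

theorem eventually_transition_eq {M Y : Type*} [TopologicalSpace M]
    [TopologicalSpace Y] {e e' : OpenPartialHomeomorph M Y} (f : M → ℝ) {y : Y}
    (hy : y ∈ e'.target) (hys : e'.symm y ∈ e.source) :
    (fun x => f (e'.symm x)) =ᶠ[𝓝 y] fun x => (fun w => f (e.symm w)) (e (e'.symm x)) := by
  filter_upwards [(e'.continuousAt_symm hy).preimage_mem_nhds (e.open_source.mem_nhds hys)]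
    with x hx
  exact congrArg f (e.left_inv hx).symm

variable {E : Type*} [NormedAddCommGroup E] {M : Type*} [TopologicalSpace M] [ChartedSpace E M]

variable (E) in
/-- The part of a set in the domain of the preferred chart at `p`, seen in this chart. -/
def chartImage (Ω : Set M) (p : M) : Set E :=
  (chartAt E p).target ∩ (chartAt E p).symm ⁻¹' Ω

theorem tendsto_chartAt_nhdsWithin (Ω : Set M) (p : M) :
    Tendsto (chartAt E p) (𝓝[Ω] p) (𝓝[chartImage E Ω p] (chartAt E p p)) := by
  refine tendsto_nhdsWithin_iff.2 ⟨((chartAt E p).continuousAt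
    (mem_chart_source E p)).tendsto.mono_left nhdsWithin_le_nhds, ?_⟩
  filter_upwards [eventually_mem_nhdsWithin, nhdsWithin_le_nhds (chart_source_mem_nhds E p)]
    with z hz hzs
  exact ⟨(chartAt E p).map_source hzs, by rwa [Set.mem_preimage, (chartAt E p).left_inv hzs]⟩

end ChartImage

section Transition

variable {E : Type*} [NormedAddCommGroup E] [NormedSpace ℂ E]
variable {M : Type*} [TopologicalSpace M] [ChartedSpace E M]

theorem contDiffAt_transition {e e' : OpenPartialHomeomorph M E}
    (he : e ∈ IsManifold.maximalAtlas 𝓘(ℂ, E) ω M) (he' : e' ∈ IsManifold.maximalAtlas 𝓘(ℂ, E) ω M)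
    {y : E} (hy : y ∈ e'.target) (hys : e'.symm y ∈ e.source) :
    ContDiffAt ℂ 2 (fun x => e (e'.symm x)) y := by
  have h1 := (contMDiffAt_of_mem_maximalAtlas he hys).comp y
    (contMDiffAt_symm_of_mem_maximalAtlas he' hy)
  exact (contMDiffAt_iff_contDiffAt.1 h1).of_le le_top

theorem contDiffAt_comp_symm {e e' : OpenPartialHomeomorph M E}
    (he : e ∈ IsManifold.maximalAtlas 𝓘(ℂ, E) ω M) (he' : e' ∈ IsManifold.maximalAtlas 𝓘(ℂ, E) ω M)
    {f : M → ℝ} {y : E} (hy : y ∈ e'.target) (hys : e'.symm y ∈ e.source)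
    (hf : ContDiffAt ℝ 2 (fun w => f (e.symm w)) (e (e'.symm y))) :
    ContDiffAt ℝ 2 (fun x => f (e'.symm x)) y :=
  (ContDiffAt.comp y (g := fun w => f (e.symm w)) (f := fun x => e (e'.symm x)) hf
    ((contDiffAt_transition he he' hy hys).restrict_scalars ℝ)).congr_of_eventuallyEq
    (eventually_transition_eq f hy hys)

theorem ddbar_comp_symm {e e' : OpenPartialHomeomorph M E}
    (he : e ∈ IsManifold.maximalAtlas 𝓘(ℂ, E) ω M) (he' : e' ∈ IsManifold.maximalAtlas 𝓘(ℂ, E) ω M)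
    {f : M → ℝ} {y : E} (hy : y ∈ e'.target) (hys : e'.symm y ∈ e.source)
    (hf : ContDiffAt ℝ 2 (fun w => f (e.symm w)) (e (e'.symm y))) (X Y : E) :
    ddbar (fun x => f (e'.symm x)) y X Y =
      ddbar (fun w => f (e.symm w)) (e (e'.symm y)) (fderiv ℝ (fun x => e (e'.symm x)) y X)
        (fderiv ℝ (fun x => e (e'.symm x)) y Y) := by
  rw [ddbar_congr (eventually_transition_eq f hy hys)]
  exact ddbar_comp_holomorphic (g := fun x => e (e'.symm x))
    (contDiffAt_transition he he' hy hys) hf X Y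

variable [IsManifold 𝓘(ℂ, E) ω M]

/-- `∂∂̄r` at `z`, computed in the preferred chart at another point `p`. -/
theorem ddbarAt_eq {r : M → ℝ} {p z : M} (hz : z ∈ (chartAt E p).source)
    (hr : ContDiffAt ℝ 2 (fun w => r ((chartAt E p).symm w)) (chartAt E p z))
    (X Y : TangentSpace 𝓘(ℝ, E) z) :
    ddbarAt r z X Y = ddbar (fun w => r ((chartAt E p).symm w)) (chartAt E p z)
      (mfderiv 𝓘(ℝ, E) 𝓘(ℝ, E) (chartAt E p) z X) (mfderiv 𝓘(ℝ, E) 𝓘(ℝ, E) (chartAt E p) z Y) := by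
  have hzz : (chartAt E z).symm (chartAt E z z) = z := (chartAt E z).left_inv (mem_chart_source E z)
  have hm : mfderiv 𝓘(ℝ, E) 𝓘(ℝ, E) (chartAt E p) z =
      fderiv ℝ (fun x => chartAt E p ((chartAt E z).symm x)) (chartAt E z z) := by
    refine ((mdifferentiable_chart_real p).mdifferentiableAt hz).mfderiv.trans ?_
    simp [writtenInExtChartAt, Function.comp_def]
    rfl
  rw [hm]
  have h := ddbar_comp_symm (f := r) (y := chartAt E z z) (e := chartAt E p) (e' := chartAt E z)
    (IsManifold.chart_mem_maximalAtlas p) (IsManifold.chart_mem_maximalAtlas z)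
    (mem_chart_target E z) (by rwa [hzz]) (by rwa [hzz]) X Y
  rw [hzz] at h
  exact h

end Transition

/-! ### Boundary points -/

section Boundary

variable {E : Type*} [NormedAddCommGroup E] [NormedSpace ℂ E]
variable {M : Type*} [TopologicalSpace M] [ChartedSpace E M]
variable [RiemannianBundle (fun x : M => TangentSpace 𝓘(ℝ, E) x)]

theorem chartNorm_self [IsManifold 𝓘(ℂ, E) ω M] (p : M) (v : TangentSpace 𝓘(ℝ, E) p) :
    chartNorm (chartAt E p) (chartAt E p p) v = ‖v‖ / √2 := by
  have h6 := chartNorm_mfderiv (mem_chart_source E p) v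
  rwa [mfderiv_chartAt_self] at h6

variable [FiniteDimensional ℂ E]

theorem norm_Lν_le (r : M → ℝ) (z : M) : ‖Lν (E := E) r z‖ ≤ √2 := by
  rw [Lν, normSqω_eq, norm_smul, norm_inv, Real.sqrt_div' _ (by norm_num),
    Real.sqrt_sq (norm_nonneg _), Real.norm_eq_abs, abs_of_nonneg (by positivity), inv_div]
  rcases eq_or_ne ‖grad (E := E) r z‖ 0 with h0 | h0
  · rw [h0, mul_zero]
    positivity
  · rw [div_mul_cancel₀ _ h0]

/-- `|∂r(L_ν)| = |∂r|`, and `|∂r|² = |dr|² / 2`. -/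
theorem norm_del_Lν_sq (hJ : IsHermitianMetric E M) (r : M → ℝ) (z : M) :
    ‖del r z (Lν (E := E) r z)‖ ^ 2 = ‖grad (E := E) r z‖ ^ 2 / 2 := by
  set g : TangentSpace 𝓘(ℝ, E) z := grad r z with hg
  have hJJ : cJ (cJ g) = -g := by
    change (Complex.I • (Complex.I • (show E from g)) : E) = -(show E from g)
    rw [smul_smul, Complex.I_mul_I, neg_one_smul]
  have hgJ : inner ℝ g (cJ g) = 0 := by
    have h1 : inner ℝ g (cJ g) = -inner ℝ g (cJ g) := by
      conv_lhs => rw [← hJ z g, hJJ, inner_neg_right, real_inner_comm]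
    linarith
  have hcJ : ∀ c : ℝ, cJ (c • g) = c • cJ g := fun c =>
    smul_comm Complex.I c (show E from g)
  have h2 : del r z (Lν (E := E) r z) = ((‖g‖ ^ 2 / 2 * (√(‖g‖ ^ 2 / 2))⁻¹ : ℝ) : ℂ) := by
    rw [← hermInner_grad hJ, Lν, hermInner, ← hg, inner_smul_left, inner_smul_left,
      hgJ, real_inner_self_eq_norm_sq, normSqω_eq]
    push_cast
    simp
    ring
  rw [h2, Complex.norm_real, Real.norm_eq_abs, sq_abs, mul_pow, inv_pow,
    Real.sq_sqrt (by positivity)]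
  rcases eq_or_ne (‖g‖ ^ 2 / 2) 0 with h0 | h0
  · rw [h0]
    simp
  · field_simp

variable [IsManifold 𝓘(ℂ, E) ω M]
variable [IsContMDiffRiemannianBundle 𝓘(ℝ, E) ∞ E (fun x : M => TangentSpace 𝓘(ℝ, E) x)]

/-- The complex Hessian, which `ddbarAt` computes in a chart that varies with the point, is locally
bounded near the boundary. -/
theorem exists_bound_ddbarAt {Ω : Set M} {r : M → ℝ} (hr : IsDefiningFunction E Ω r) {p : M}
    (hp : p ∈ frontier Ω) :
    ∃ C : ℝ, ∀ᶠ z in 𝓝 p, ∀ X Y : TangentSpace 𝓘(ℝ, E) z, ‖X‖ ≤ √2 → ‖Y‖ ≤ √2 →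
      ‖ddbarAt r z X Y‖ ≤ C := by
  obtain ⟨U, hU, hUf, hrU⟩ := hr.smooth
  set e := chartAt E p with he
  have hps : p ∈ e.source := mem_chart_source E p
  have hpt : e p ∈ e.target := e.map_source hps
  set u : E → ℝ := fun x => r (e.symm x) with hu
  have hux : ContDiffAt ℝ 2 u (e p) :=
    contDiffAt_comp_chart_symm hU hrU p hpt (by rw [e.left_inv hps]; exact hUf hp)
  obtain ⟨c, B, hc, hB, hnB⟩ := exists_norm_equiv (n := chartNorm e) (x₀ := e p)
    (fun X => continuousAt_chartNorm hpt X) (fun X hX => chartNorm_pos hpt hX)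
  set H := ‖fderiv ℝ (fderiv ℝ u) (e p)‖ + 1 with hH
  have hHn : ∀ᶠ y in 𝓝 (e p), ‖fderiv ℝ (fderiv ℝ u) y‖ < H := by
    exact eventually_norm_hessian_lt hux
  have hcont : Tendsto e (𝓝 p) (𝓝 (e p)) := e.continuousAt hps
  refine ⟨H * c⁻¹ * c⁻¹, ?_⟩
  filter_upwards [hcont.eventually hnB, hcont.eventually hHn, e.open_source.mem_nhds hps,
    hcont.eventually (hux.eventually (by simp))] with z hz hzH hzs hzu X Y hX hY
  have hb : ∀ v : TangentSpace 𝓘(ℝ, E) z, ‖v‖ ≤ √2 →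
      ‖(show E from mfderiv 𝓘(ℝ, E) 𝓘(ℝ, E) e z v)‖ ≤ c⁻¹ := by
    intro v hv
    have h1 := (hz (show E from mfderiv 𝓘(ℝ, E) 𝓘(ℝ, E) e z v)).1
    have h2 : chartNorm e (e z) (show E from mfderiv 𝓘(ℝ, E) 𝓘(ℝ, E) e z v) = ‖v‖ / √2 :=
      chartNorm_mfderiv hzs v
    rw [h2] at h1
    have h3 : ‖v‖ / √2 ≤ 1 := (div_le_one (by positivity)).2 hv
    rw [← one_div, le_div_iff₀ hc]
    linarith
  have key : ∀ v w : E, ‖v‖ ≤ c⁻¹ → ‖w‖ ≤ c⁻¹ → ‖ddbar u (e z) v w‖ ≤ H * c⁻¹ * c⁻¹ := by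
    intro v w hv hw
    have hH0 : 0 ≤ H := by positivity
    refine (norm_leviForm_le _ _ _).trans ?_
    gcongr
  rw [ddbarAt_eq hzs hzu]
  exact key _ _ (hb X hX) (hb Y hY)

/-- `S(r)` is finite, since the boundary is compact. -/
theorem mixedLevi_ne_top {Ω : Set M} (hbdd : IsCompact (closure Ω)) {r : M → ℝ}
    (hr : IsDefiningFunction E Ω r) : mixedLevi E Ω r ≠ ⊤ := by
  have hcomp : IsCompact (frontier Ω) :=
    hbdd.of_isClosed_subset isClosed_frontier frontier_subset_closure
  obtain ⟨C, hC⟩ : ∃ C : ℝ, ∀ z ∈ frontier Ω, ∀ X Y : TangentSpace 𝓘(ℝ, E) z, ‖X‖ ≤ √2 →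
      ‖Y‖ ≤ √2 → ‖ddbarAt r z X Y‖ ≤ C := by
    refine hcomp.induction_on (p := fun s => ∃ C : ℝ, ∀ z ∈ s, ∀ X Y : TangentSpace 𝓘(ℝ, E) z,
      ‖X‖ ≤ √2 → ‖Y‖ ≤ √2 → ‖ddbarAt r z X Y‖ ≤ C) ?_ ?_ ?_ ?_
    · exact ⟨0, fun z hz => hz.elim⟩
    · rintro s t hst ⟨C, hC⟩
      exact ⟨C, fun z hz => hC z (hst hz)⟩
    · rintro s t ⟨C, hC⟩ ⟨C', hC'⟩
      refine ⟨max C C', fun z hz X Y hX hY => ?_⟩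
      rcases hz with hz | hz
      · exact (hC z hz X Y hX hY).trans (le_max_left _ _)
      · exact (hC' z hz X Y hX hY).trans (le_max_right _ _)
    · intro p hp
      obtain ⟨C, hC⟩ := exists_bound_ddbarAt hr hp
      exact ⟨_, nhdsWithin_le_nhds hC, C, fun z hz => hz⟩
  refine ne_top_of_le_ne_top (ENNReal.ofReal_ne_top (r := C)) ?_
  refine iSup₂_le fun z hz => iSup₂_le fun X hX => ENNReal.ofReal_le_ofReal ?_
  refine hC z hz.1 X _ ?_ (norm_Lν_le r z)
  have h1 := hX.2
  rw [normSqω_eq] at h1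
  exact Real.le_sqrt_of_sq_le (by linarith)

/-- The definition of `S(r)`, in the preferred chart at a boundary point. -/
theorem norm_ddbar_Lν_le {Ω : Set M} (hbdd : IsCompact (closure Ω)) {r : M → ℝ}
    (hr : IsDefiningFunction E Ω r) {p : M} (hp : p ∈ frontier Ω) {K : ℝ}
    (hO : OkaAt (fun x => r ((chartAt E p).symm x)) (chartImage E Ω p)
      (chartNorm (chartAt E p)) K (chartAt E p p))
    (hL : delForm (fderiv ℝ (fun x => r ((chartAt E p).symm x)) (chartAt E p p))
      (Lν (E := E) r p) ≠ 0)
    {T : E} (hT0 : T ≠ 0)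
    (hT : delForm (fderiv ℝ (fun x => r ((chartAt E p).symm x)) (chartAt E p p)) T = 0)
    (hq : (ddbar (fun x => r ((chartAt E p).symm x)) (chartAt E p p) T T).re = 0) :
    ‖ddbar (fun x => r ((chartAt E p).symm x)) (chartAt E p p) T (Lν (E := E) r p)‖ ≤
      (mixedLevi E Ω r).toReal * chartNorm (chartAt E p) (chartAt E p p) T := by
  set e := chartAt E p with he
  set u : E → ℝ := fun x => r (e.symm x) with hu
  have hd : DifferentiableAt ℝ u (e p) := hO.contDiffAt.differentiableAt (by norm_num)
  have hsymm := fderiv_fderiv_symm hO.contDiffAt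
  have hdel : ∀ X : TangentSpace 𝓘(ℝ, E) p, delForm (fderiv ℝ u (e p)) X = del r p X :=
    delForm_comp_chart_self hd
  have hpos : ∀ X : E, delForm (fderiv ℝ u (e p)) X = 0 →
      0 ≤ (leviForm (fderiv ℝ (fderiv ℝ u) (e p)) X X).re := fun X hX => hO.levi_nonneg hL hX
  set m := chartNorm e (e p) T with hm
  have hm0 : 0 < m := hO.n_pos T hT0
  let T' : TangentSpace 𝓘(ℝ, E) p := ((m⁻¹ : ℝ) : ℂ) • T
  have hT'0 : T' ≠ 0 := by
    change ((m⁻¹ : ℝ) : ℂ) • T ≠ 0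
    exact smul_ne_zero (by simpa using hm0.ne') hT0
  have hT' : delForm (fderiv ℝ u (e p)) T' = 0 := by
    change delForm (fderiv ℝ u (e p)) (((m⁻¹ : ℝ) : ℂ) • T) = 0
    rw [delForm_smul, hT, mul_zero]
  have hq' : (leviForm (fderiv ℝ (fderiv ℝ u) (e p)) T' T').re = 0 := by
    change (leviForm (fderiv ℝ (fderiv ℝ u) (e p)) (((m⁻¹ : ℝ) : ℂ) • T)
      (((m⁻¹ : ℝ) : ℂ) • T)).re = 0
    rw [leviForm_self_re_smul _ hsymm, ← ddbar_eq_leviForm, hq, mul_zero]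
  have hnorm : normSqω T' = 1 := by
    have h1 : ‖T'‖ / √2 = m⁻¹ * m := by
      rw [← chartNorm_self]
      change chartNorm e (e p) (((m⁻¹ : ℝ) : ℂ) • T) = _
      rw [Complex.coe_smul, map_smul_eq_mul, Real.norm_eq_abs, abs_of_pos (by positivity)]
    rw [inv_mul_cancel₀ hm0.ne', div_eq_one_iff_eq (by positivity)] at h1
    rw [normSqω_eq, h1, Real.sq_sqrt (by norm_num)]
    norm_num
  have hW : p ∈ weaklyPseudoconvex E Ω r := by
    refine ⟨hp, fun X hX => ?_, T', hT'0, ?_, hq'⟩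
    · exact hpos X ((hdel X).trans hX)
    · rw [← hdel, hT']
  have hnull : T' ∈ leviNull r p := by
    refine ⟨by rw [← hdel, hT'], fun Y hY => ?_⟩
    exact leviForm_eq_zero_of_isotropic _ _ hsymm hpos hT' hq' ((hdel Y).trans hY)
  have hle : ENNReal.ofReal ‖ddbarAt r p T' (Lν r p)‖ ≤ mixedLevi E Ω r :=
    le_iSup₂_of_le p hW (le_iSup₂_of_le T' ⟨hnull, hnorm⟩ le_rfl)
  rw [ENNReal.ofReal_le_iff_le_toReal (mixedLevi_ne_top hbdd hr)] at hle
  have h2 : ‖ddbarAt r p T' (Lν r p)‖ = m⁻¹ * ‖ddbar u (e p) T (Lν (E := E) r p)‖ := by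
    have h3 : ddbarAt r p T' (Lν r p) = ((m⁻¹ : ℝ) : ℂ) * ddbar u (e p) T (Lν (E := E) r p) :=
      leviForm_smul_left _ _ _ _
    rw [h3, norm_mul, Complex.norm_real, Real.norm_eq_abs, abs_of_pos (by positivity)]
  rw [h2, inv_mul_eq_div, div_le_iff₀ hm0] at hle
  exact hle

variable [MeasurableSpace E] [BorelSpace E]

/-- An Oka constant yields the pointwise estimate in the preferred chart at a boundary point. -/
theorem IsOkaConstant.okaAt {Ω : Set M} (hopen : IsOpen Ω) {r : M → ℝ}
    (hr : IsDefiningFunction E Ω r) {K : ℝ} (hK : IsOkaConstant E Ω r K) {p : M}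
    (hp : p ∈ frontier Ω) :
    OkaAt (fun x => r ((chartAt E p).symm x)) (chartImage E Ω p) (chartNorm (chartAt E p)) K
      (chartAt E p p) := by
  obtain ⟨hK0, U, hU, hUf, hge⟩ := hK
  obtain ⟨U', hU', hUf', hrU⟩ := hr.smooth
  set e := chartAt E p with he
  have hps : p ∈ e.source := mem_chart_source E p
  have hpt : e p ∈ e.target := e.map_source hps
  have hpp : e.symm (e p) = p := e.left_inv hps
  set u : E → ℝ := fun x => r (e.symm x) with hu
  have hV : IsOpen (e.target ∩ e.symm ⁻¹' (U ∩ U')) := e.isOpen_inter_preimage_symm (hU.inter hU')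
  have hVΩ : IsOpen (e.target ∩ e.symm ⁻¹' (U ∩ U' ∩ Ω)) :=
    e.isOpen_inter_preimage_symm ((hU.inter hU').inter hopen)
  have hC2 : ∀ y ∈ e.target ∩ e.symm ⁻¹' (U ∩ U'), ContDiffAt ℝ 2 u y := fun y hy =>
    contDiffAt_comp_chart_symm hU' hrU p hy.1 hy.2.2
  have hmemV : e p ∈ e.target ∩ e.symm ⁻¹' (U ∩ U') :=
    ⟨hpt, by rw [Set.mem_preimage, hpp]; exact ⟨hUf hp, hUf' hp⟩⟩
  have hneg : ∀ y ∈ e.target ∩ e.symm ⁻¹' (U ∩ U' ∩ Ω), u y < 0 := fun y hy =>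
    hr.neg _ hy.2.2
  have hpoint : ∀ X : E, ∀ y ∈ e.target ∩ e.symm ⁻¹' (U ∩ U' ∩ Ω),
      K * normSqω (mfderiv 𝓘(ℝ, E) 𝓘(ℝ, E) e.symm y X) ≤
        (ddbar (fun x => -Real.log (-u x)) y X X).re := by
    intro X
    refine le_ddbar_of_forall_test hVΩ ?_ ?_ ?_
    · intro y hy
      exact ((hC2 y ⟨hy.1, hy.2.1⟩).neg.log (by linarith [hneg y hy] : -u y ≠ 0)).neg
    · intro y hy
      simp only [normSqω_mfderiv_symm]
      have h1 := continuousAt_chartNorm (p := p) hy.1 X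
      have h2 : ContinuousAt (fun y => chartNorm e y X) y :=
        ContinuousAt.comp (x := y) (f := fun y : E => (y, X))
          (g := fun z : E × E => chartNorm e z.1 z.2) h1 (by fun_prop)
      exact (continuousAt_const.mul (h2.pow 2)).continuousWithinAt
    · intro φ h1 h2 h3 h4
      exact hge e (IsManifold.chart_mem_maximalAtlas p) X φ h1 h2 h3
        (h4.trans fun y hy => ⟨hy.1, hy.2.1.1, hy.2.2⟩)
  have hev : ∀ᶠ y in 𝓝[chartImage E Ω p] (e p), y ∈ e.target ∩ e.symm ⁻¹' (U ∩ U' ∩ Ω) := by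
    filter_upwards [eventually_mem_nhdsWithin, nhdsWithin_le_nhds (hV.mem_nhds hmemV)] with y h1 h2
    exact ⟨h1.1, h2.2, h1.2⟩
  refine ⟨hC2 _ hmemV, ?_, ?_, hK0, fun X => continuousAt_chartNorm hpt X,
    fun X hX => chartNorm_pos hpt hX, hev.mono hneg, ?_⟩
  · have : (𝓝[Ω] p).NeBot := mem_closure_iff_nhdsWithin_neBot.1 (frontier_subset_closure hp)
    exact mem_closure_iff_nhdsWithin_neBot.2 ((tendsto_chartAt_nhdsWithin Ω p).neBot)
  · simp only [hu, hpp]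
    exact hr.eq_zero hp
  · filter_upwards [hev] with y hy X
    have huy := hneg y hy
    have h1 := hpoint X y hy
    have hφ : ∀ᶠ t in 𝓝 (u y), HasDerivAt (fun t => -Real.log (-t)) (-t⁻¹) t := by
      filter_upwards [gt_mem_nhds huy] with t ht
      convert! ((hasDerivAt_neg t).log (by linarith)).neg using 1
      field_simp
    have hφ' : HasDerivAt (fun t : ℝ => -t⁻¹) ((u y ^ 2)⁻¹) (u y) := by
      convert! (hasDerivAt_inv huy.ne).neg using 1
      rw [neg_neg]
    rw [ddbar_comp_re (φ := fun t => -Real.log (-t)) (hC2 y ⟨hy.1, hy.2.1⟩) hφ hφ',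
      normSqω_mfderiv_symm] at h1
    refine h1.trans (le_of_eq ?_)
    rw [div_eq_inv_mul, div_eq_inv_mul, inv_neg]

end Boundary

/-! ### The Diederich–Fornæss index -/

/-- The complex Hessian of `-(-u)^η` is a positive multiple of
`(-u) ∂∂̄u + (1 - η) ∂u ∧ ∂̄u`. -/
theorem ddbar_neg_rpow {E : Type*} [NormedAddCommGroup E] [NormedSpace ℂ E] {u : E → ℝ} {y : E}
    (hu : ContDiffAt ℝ 2 u y) (hneg : u y < 0) (η : ℝ) (X : E) :
    (ddbar (fun x => -(-u x) ^ η) y X X).re = η * (-u y) ^ (η - 2) *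
      ((-u y) * (ddbar u y X X).re + (1 - η) * ‖delForm (fderiv ℝ u y) X‖ ^ 2) := by
  have hφ : ∀ᶠ t in 𝓝 (u y), HasDerivAt (fun t : ℝ => -(-t) ^ η) (η * (-t) ^ (η - 1)) t := by
    filter_upwards [gt_mem_nhds hneg] with t ht
    convert! ((hasDerivAt_neg t).rpow_const (p := η) (Or.inl (by linarith))).neg using 1
    ring
  have hφ' : HasDerivAt (fun t : ℝ => η * (-t) ^ (η - 1))
      (η * (1 - η) * (-u y) ^ (η - 2)) (u y) := by
    convert! (((hasDerivAt_neg (u y)).rpow_const (p := η - 1)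
      (Or.inl (by linarith))).const_mul η) using 1
    rw [show η - 1 - 1 = η - 2 by ring]
    ring
  have hpow : (-u y) ^ (η - 1) = (-u y) ^ (η - 2) * (-u y) := by
    rw [← Real.rpow_add_one (by linarith)]
    congr 1
    ring
  rw [ddbar_comp_re (φ := fun t => -(-t) ^ η) hu hφ hφ', hpow]
  ring

section Exponents

variable {E : Type*} [NormedAddCommGroup E] [NormedSpace ℂ E] [FiniteDimensional ℂ E]
variable [MeasurableSpace E] [BorelSpace E]
variable {M : Type*} [TopologicalSpace M] [ChartedSpace E M]
variable [RiemannianBundle (fun x : M => TangentSpace 𝓘(ℝ, E) x)]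

/-- Below `I₀(r)` there is room for an Oka constant `K` and the two weights of the estimate: the
second term of `I₀(r)` corresponds to `τ = 1`, the first one to `s = 1 / 2`. -/
theorem exists_weights {Ω : Set M} {r : M → ℝ} (hS : mixedLevi E Ω r ≠ ⊤) (hOka : StrongOka E Ω r)
    {η : ℝ} (hη0 : 0 < η) (hη : ENNReal.ofReal η < I₀ E Ω r) :
    ∃ K τ s : ℝ, IsOkaConstant E Ω r K ∧ 0 ≤ τ ∧ τ ≤ 1 ∧ 0 < s ∧ η < τ * (1 - s) ∧
      τ * (mixedLevi E Ω r).toReal ^ 2 < K * s / 2 := by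
  have hexK : ∀ x : ℝ, ENNReal.ofReal x < okaIndex E Ω r → ∃ K, IsOkaConstant E Ω r K ∧ x < K := by
    intro x hx
    obtain ⟨K, hx⟩ := lt_iSup_iff.1 hx
    obtain ⟨hK, hx⟩ := lt_iSup_iff.1 hx
    exact ⟨K, hK, (ENNReal.ofReal_lt_ofReal_iff hK.1).1 hx⟩
  have hoka0 : okaIndex E Ω r ≠ 0 := by
    obtain ⟨K, hK⟩ := hOka
    have : ENNReal.ofReal K ≤ okaIndex E Ω r := le_iSup₂_of_le K hK le_rfl
    exact ((ENNReal.ofReal_pos.2 hK.1).trans_le this).ne'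
  set S := (mixedLevi E Ω r).toReal with hSdef
  have hS0 : 0 ≤ S := ENNReal.toReal_nonneg
  have hSe : mixedLevi E Ω r = ENNReal.ofReal S := (ENNReal.ofReal_toReal hS).symm
  rw [I₀, hSe, ← ENNReal.ofReal_pow hS0] at hη
  rcases lt_max_iff.1 hη with h | h
  · obtain ⟨h1, h2⟩ := lt_min_iff.1 h
    have h2' : η < 1 / 2 := by
      rw [show (1 / 2 : ℝ≥0∞) = ENNReal.ofReal (1 / 2) by
        rw [ENNReal.ofReal_div_of_pos (by norm_num)]; simp] at h2
      exact (ENNReal.ofReal_lt_ofReal_iff (by norm_num)).1 h2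
    have h1' := ENNReal.mul_lt_of_lt_div h1
    rw [show (8 : ℝ≥0∞) = ENNReal.ofReal 8 by simp, ← ENNReal.ofReal_mul (by norm_num),
      ← ENNReal.ofReal_mul hη0.le] at h1'
    obtain ⟨K, hK, hKlt⟩ := hexK _ h1'
    have hc : Tendsto (fun t : ℝ => t * S ^ 2) (𝓝[>] (2 * η)) (𝓝 (2 * η * S ^ 2)) :=
      ((continuous_id.mul continuous_const).tendsto (2 * η)).mono_left nhdsWithin_le_nhds
    obtain ⟨τ, h3, h4⟩ :=
      ((hc.eventually (gt_mem_nhds (show 2 * η * S ^ 2 < K / 4 by linarith))).and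
      (Ioo_mem_nhdsGT (show 2 * η < 1 by linarith))).exists
    exact ⟨K, τ, 1 / 2, hK, by linarith [h4.1], h4.2.le, by norm_num, by linarith [h4.1],
      by linarith⟩
  · rw [lt_tsub_iff_right] at h
    have hη1 : η < 1 := by
      have h3 := lt_of_le_of_lt le_self_add h
      rw [← ENNReal.ofReal_one] at h3
      exact (ENNReal.ofReal_lt_ofReal_iff one_pos).1 h3
    have h4 : 2 * ENNReal.ofReal (S ^ 2) / okaIndex E Ω r < ENNReal.ofReal (1 - η) := by
      rw [ENNReal.ofReal_sub _ hη0.le, ENNReal.ofReal_one, lt_tsub_iff_left]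
      exact h
    rw [show (2 : ℝ≥0∞) = ENNReal.ofReal 2 by simp, ← ENNReal.ofReal_mul (by norm_num),
      ENNReal.div_lt_iff (Or.inl hoka0) (Or.inr ENNReal.ofReal_ne_top)] at h4
    have h5 : ENNReal.ofReal (2 * S ^ 2 / (1 - η)) < okaIndex E Ω r := by
      rw [ENNReal.ofReal_div_of_pos (by linarith)]
      refine ENNReal.div_lt_of_lt_mul' h4
    obtain ⟨K, hK, hKlt⟩ := hexK _ h5
    have hK0 := hK.1
    rw [div_lt_iff₀ (by linarith)] at hKlt
    obtain ⟨s, hs1, hs2⟩ := exists_between (show 2 * S ^ 2 / K < 1 - η by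
      rw [div_lt_iff₀ hK0]; linarith)
    have hs0 : 0 < s := lt_of_le_of_lt (by positivity) hs1
    rw [div_lt_iff₀ hK0] at hs1
    exact ⟨K, 1, s, hK, zero_le_one, le_rfl, hs0, by linarith, by linarith⟩

theorem I₀_pos {Ω : Set M} {r : M → ℝ} (hS : mixedLevi E Ω r ≠ ⊤) (hOka : StrongOka E Ω r) :
    0 < I₀ E Ω r := by
  obtain ⟨K, hK⟩ := hOka
  have h1 : ENNReal.ofReal K ≤ okaIndex E Ω r := le_iSup₂_of_le K hK le_rfl
  have h2 : 0 < okaIndex E Ω r := (ENNReal.ofReal_pos.2 hK.1).trans_le h1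
  refine lt_max_of_lt_left (lt_min (ENNReal.div_pos h2.ne' ?_) (by simp))
  exact ENNReal.mul_ne_top (by simp) (ENNReal.pow_ne_top hS)

variable [T2Space M] [IsManifold 𝓘(ℂ, E) ω M]
variable [IsContMDiffRiemannianBundle 𝓘(ℝ, E) ∞ E (fun x : M => TangentSpace 𝓘(ℝ, E) x)]

/-- The plurisubharmonicity of `-(-r)^η` near a boundary point, in the preferred chart. -/
theorem IsOkaConstant.eventually_ddbar_nonneg (hω : IsHermitianMetric E M) {Ω : Set M}
    (hopen : IsOpen Ω) (hbdd : IsCompact (closure Ω)) {r : M → ℝ}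
    (hr : IsDefiningFunction E Ω r) (hnorm : IsNormalized E Ω r) {K : ℝ}
    (hK : IsOkaConstant E Ω r K) {τ s η : ℝ} (hη0 : 0 < η) (hτ0 : 0 ≤ τ) (hτ1 : τ ≤ 1)
    (hs : 0 < s) (hη : η < τ * (1 - s))
    (hτS : τ * (mixedLevi E Ω r).toReal ^ 2 < K * s / 2) {p : M} (hp : p ∈ frontier Ω) :
    ∀ᶠ z in 𝓝[Ω] p, z ∈ (chartAt E p).source ∧
      ContDiffAt ℝ 2 (fun x => -(-r ((chartAt E p).symm x)) ^ η) (chartAt E p z) ∧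
      ∀ X, 0 ≤ (ddbar (fun x => -(-r ((chartAt E p).symm x)) ^ η) (chartAt E p z) X X).re := by
  have hO := hK.okaAt hopen hr hp
  have hL : 1 / 2 ≤ ‖delForm (fderiv ℝ (fun x => r ((chartAt E p).symm x)) (chartAt E p p))
      (Lν (E := E) r p)‖ ^ 2 := by
    rw [delForm_comp_chart_self (hO.contDiffAt.differentiableAt (by norm_num)),
      norm_del_Lν_sq hω]
    have h1 := one_le_norm_grad hopen hr hnorm hp
    have h2 : 1 ≤ ‖grad (E := E) r p‖ ^ 2 := one_le_pow₀ h1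
    linarith
  have hL0 : delForm (fderiv ℝ (fun x => r ((chartAt E p).symm x)) (chartAt E p p))
      (Lν (E := E) r p) ≠ 0 := by
    intro h0
    rw [h0] at hL
    norm_num at hL
  have hev := hO.eventually_df_inequality hL
    (fun T hT0 hT hq => norm_ddbar_Lν_le hbdd hr hp hO hL0 hT0 hT hq) hτ0 hτ1 hs hη hτS
  have hC2 : ∀ᶠ y in 𝓝[chartImage E Ω p] (chartAt E p p),
      ContDiffAt ℝ 2 (fun x => r ((chartAt E p).symm x)) y :=
    nhdsWithin_le_nhds (hO.contDiffAt.eventually (by simp))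
  have ht := tendsto_chartAt_nhdsWithin (E := E) Ω p
  filter_upwards [ht.eventually hev, ht.eventually hC2, ht.eventually hO.neg,
    nhdsWithin_le_nhds (chart_source_mem_nhds E p)] with z h1 h2 h3 h4
  refine ⟨h4, ?_, fun X => ?_⟩
  · exact (h2.neg.rpow_const_of_ne (by linarith)).neg
  · rw [ddbar_neg_rpow h2 h3]
    exact mul_nonneg (mul_nonneg hη0.le (Real.rpow_nonneg (by linarith) _)) (h1 X)

/-- The inequality at interior points near the boundary, once known in the preferred charts of
boundary points, passes to every holomorphic chart by the invariance of the complex Hessian. -/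
theorem IsOkaConstant.isDFExponent (hω : IsHermitianMetric E M) {Ω : Set M}
    (hopen : IsOpen Ω) (hbdd : IsCompact (closure Ω)) {r : M → ℝ}
    (hr : IsDefiningFunction E Ω r) (hnorm : IsNormalized E Ω r) {K : ℝ}
    (hK : IsOkaConstant E Ω r K) {τ s η : ℝ} (hη0 : 0 < η) (hτ0 : 0 ≤ τ) (hτ1 : τ ≤ 1)
    (hs : 0 < s) (hη : η < τ * (1 - s))
    (hτS : τ * (mixedLevi E Ω r).toReal ^ 2 < K * s / 2) : IsDFExponent E Ω r η := by
  have hη1 : η ≤ 1 := by nlinarith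
  have hloc : ∀ p ∈ frontier Ω, ∃ V : Set M, IsOpen V ∧ p ∈ V ∧ ∀ z ∈ V ∩ Ω,
      z ∈ (chartAt E p).source ∧
      ContDiffAt ℝ 2 (fun x => -(-r ((chartAt E p).symm x)) ^ η) (chartAt E p z) ∧
      ∀ X, 0 ≤ (ddbar (fun x => -(-r ((chartAt E p).symm x)) ^ η) (chartAt E p z) X X).re := by
    intro p hp
    have hev := hK.eventually_ddbar_nonneg hω hopen hbdd hr hnorm hη0 hτ0 hτ1 hs hη hτS hp
    obtain ⟨V, hV, hpV, hVs⟩ := mem_nhdsWithin.1 hev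
    exact ⟨V, hV, hpV, hVs⟩
  choose! V hVo hpV hV using hloc
  have hUo : IsOpen (⋃ p ∈ frontier Ω, V p) := isOpen_biUnion hVo
  refine ⟨hη0, hη1, ⋃ p ∈ frontier Ω, V p, hUo,
    fun p hp => Set.mem_biUnion hp (hpV p hp), ?_⟩
  intro e he X φ hφ hc hφ0 hsupp
  simp only [zero_mul, integral_zero]
  have hpt : ∀ y ∈ e.target ∩ e.symm ⁻¹' ((⋃ p ∈ frontier Ω, V p) ∩ Ω),
      ContDiffAt ℝ 2 (fun x => -(-r (e.symm x)) ^ η) y ∧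
        0 ≤ (ddbar (fun x => -(-r (e.symm x)) ^ η) y X X).re := by
    rintro y ⟨hyt, hyU, hyΩ⟩
    obtain ⟨p, hp, hyV⟩ := Set.mem_iUnion₂.1 hyU
    obtain ⟨h1, h2, h3⟩ := hV p hp _ ⟨hyV, hyΩ⟩
    have hpm : chartAt E p ∈ IsManifold.maximalAtlas 𝓘(ℂ, E) ω M :=
      IsManifold.chart_mem_maximalAtlas p
    refine ⟨contDiffAt_comp_symm (f := fun z => -(-r z) ^ η) hpm he hyt h1 h2, ?_⟩
    rw [ddbar_comp_symm (f := fun z => -(-r z) ^ η) hpm he hyt h1 h2]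
    exact h3 _
  exact integral_mul_ddbar_nonneg (e.isOpen_inter_preimage_symm (hUo.inter hopen))
    (fun y hy => (hpt y hy).1) (fun y hy => (hpt y hy).2) hφ hc hφ0 hsupp

end Exponents

end DFOka
end

theorem theorem2p1
    {E : Type*} [NormedAddCommGroup E] [NormedSpace ℂ E] [FiniteDimensional ℂ E]
    [MeasurableSpace E] [BorelSpace E]
    {M : Type*} [TopologicalSpace M] [T2Space M] [SecondCountableTopology M]
    [ChartedSpace E M] [IsManifold 𝓘(ℂ, E) ω M]
    [RiemannianBundle (fun x : M => TangentSpace 𝓘(ℝ, E) x)]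
    [IsContMDiffRiemannianBundle 𝓘(ℝ, E) ∞ E (fun x : M => TangentSpace 𝓘(ℝ, E) x)]
    (hω : DFOka.IsHermitianMetric E M)
    (Ω : Set M) (hopen : IsOpen Ω) (hconn : IsConnected Ω) (hbdd : IsCompact (closure Ω))
    (hC2 : DFOka.HasC2Boundary E Ω)
    (r : M → ℝ) (hr : DFOka.IsDefiningFunction E Ω r) (hnorm : DFOka.IsNormalized E Ω r)
    (hOka : DFOka.StrongOka E Ω r) :
    0 < DFOka.I₀ E Ω r ∧ DFOka.I₀ E Ω r ≤ DFOka.dfIndex E Ω r := by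
  have hS := DFOka.mixedLevi_ne_top hbdd hr
  refine ⟨DFOka.I₀_pos hS hOka, le_of_forall_lt_imp_le_of_dense fun c hc => ?_⟩
  have hctop : c ≠ ⊤ := hc.ne_top
  rcases eq_or_ne c 0 with rfl | hc0
  · exact bot_le
  · have hη0 : 0 < c.toReal := ENNReal.toReal_pos hc0 hctop
    rw [← ENNReal.ofReal_toReal hctop] at hc ⊢
    obtain ⟨K, τ, s, hK, hτ0, hτ1, hs, hη, hτS⟩ := DFOka.exists_weights hS hOka hη0 hc
    exact le_iSup₂_of_le c.toReal
      (hK.isDFExponent hω hopen hbdd hr hnorm hη0 hτ0 hτ1 hs hη hτS) le_rfl
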